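/- Let $\mathbb F$ be a field, $p\in\mathbb F$ with $p\neq 0$, and let $V$ be an $\mathbb F$-vector space (of arbitrary dimension) with a linearly ordered basis $\mathbb B$. For $a,b\in\mathbb B$ put $\theta_{a,b}=1$ if $a>b$ and $\theta_{a,b}=0$ otherwise, and for finite subsets $A,B\subseteq\mathbb B$ put $\theta_{A,B}=\sum_{a\in A}\sum_{b\in B}\theta_{a,b}$. Let $\tau\colon V\otimes V\to V\otimes V$ be the linear map with $$\tau(a\otimes b)=(p^{\theta_{a,b}}-1)\,a\otimes b-p^{\theta_{b,a}}\,b\otimes a,\qquad a,b\in\mathbb B .$$ For a finite subset $E=\{e_1<\dots<e_k\}$ of $\mathbb B$ let $f_E=e_1e_2\cdots e_k\in\bigwedge V$ (so $f_\emptyset=1$). A braided Hopf algebra structure on a unital associative algebra $H$ with product $\nabla$ and unit $\eta$ consists of an invertible linear map $\beta\colon H\otimes H\to H\otimes H$ (the braiding) satisfying the Yang--Baxter equation, and linear maps $\Delta,\varepsilon,S$, such that $(H,\Delta,\varepsilon)$ is a coassociative counital coalgebra; the maps $\nabla,\eta,\Delta,\varepsilon,S$ commute with the braiding (they are morphisms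 of braided vector spaces); $\varepsilon$ is an algebra map, $\Delta(1)=1\otimes 1$ and $\Delta\nabla=(\nabla\otimes\nabla)(\mathrm{id}\otimes\beta\otimes\mathrm{id})(\Delta\otimes\Delta)$; and $\nabla(S\otimes\mathrm{id})\Delta=\eta\varepsilon=\nabla(\mathrm{id}\otimes S)\Delta$. Then the elements $f_E$, for $E$ a finite subset of $\mathbb B$, form a basis of $\bigwedge V$. There is exactly one braided Hopf algebra structure on the algebra $\bigwedge V$ in which all elements of $V$ are primitive and whose braiding restricts to $\tau$ on $V\otimes V$; denote it by $\Lambda_p(V)$. Its structure maps are given, for all finite subsets $E,F$ of $\mathbb B$, by - product: $\nabla(f_E\otimes f_F)=(-1)^{\theta_{E,F}}f_{E\cup F}$ if $E\cap F=\emptyset$, and $\nabla(f_E\otimes f_F)=0$ otherwise; - coproduct: $\Delta f_E=\sum_{A\subseteq E}(-p)^{\theta_{A,E\setminus A}}\,f_A\otimes f_{E\setminus A}$; - antipode: $S f_E=(-1)^{|E|}p^{|E|(|E|-1)/2}f_E$. -/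

import Mathlib

open scoped TensorProduct

namespace BraidedExterior

noncomputable section

/-! ### Braided Hopf algebras over a field -/

section Braided

variable {F H : Type*} [Field F] [Ring H] [Algebra F H]

/-- `β ⊗ id` on `(H ⊗ H) ⊗ H`. -/
def onFirst (β : H ⊗[F] H →ₗ[F] H ⊗[F] H) : (H ⊗[F] H) ⊗[F] H →ₗ[F] (H ⊗[F] H) ⊗[F] H :=
  β.rTensor H

/-- `id ⊗ β` on `(H ⊗ H) ⊗ H ≅ H ⊗ (H ⊗ H)`. -/
def onSecond (β : H ⊗[F] H →ₗ[F] H ⊗[F] H) : (H ⊗[F] H) ⊗[F] H →ₗ[F] (H ⊗[F] H) ⊗[F] H :=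
  (TensorProduct.assoc F H H H).symm.toLinearMap ∘ₗ β.lTensor H ∘ₗ
    (TensorProduct.assoc F H H H).toLinearMap

/-- `id ⊗ β ⊗ id` on `(H ⊗ H) ⊗ (H ⊗ H)`: it braids the two inner factors. -/
def onMiddle (β : H ⊗[F] H →ₗ[F] H ⊗[F] H) :
    (H ⊗[F] H) ⊗[F] (H ⊗[F] H) →ₗ[F] (H ⊗[F] H) ⊗[F] (H ⊗[F] H) :=
  (TensorProduct.assoc F H H (H ⊗[F] H)).symm.toLinearMap ∘ₗ
    ((TensorProduct.assoc F H H H).toLinearMap ∘ₗ β.rTensor H ∘ₗ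
      (TensorProduct.assoc F H H H).symm.toLinearMap).lTensor H ∘ₗ
    (TensorProduct.assoc F H H (H ⊗[F] H)).toLinearMap

end Braided

/-- The data `(β, Δ, ε, S)` that make an associative unital `F`-algebra `H`, with its given product
`∇ = LinearMap.mul' F H` and unit, into a braided Hopf algebra (a Hopf object in a braided category
of vector spaces, with `β = β_{H,H}`). Coassociativity and counitality of `Δ`, `ε` are those of
`Coalgebra`. -/
structure BraidedHopfStructure (F H : Type*) [Field F] [Ring H] [Algebra F H] extends
    Coalgebra F H where
  /-- the braiding `β_{H,H}`, an invertible linear map -/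
  braiding : (H ⊗[F] H) ≃ₗ[F] (H ⊗[F] H)
  /-- the antipode `S` -/
  antipode : H →ₗ[F] H
  /-- the Yang-Baxter equation -/
  yang_baxter :
    onFirst braiding.toLinearMap ∘ₗ onSecond braiding.toLinearMap ∘ₗ onFirst braiding.toLinearMap =
    onSecond braiding.toLinearMap ∘ₗ onFirst braiding.toLinearMap ∘ₗ onSecond braiding.toLinearMap
  /-- `β (η ⊗ id) = id ⊗ η` -/
  braiding_one_left : ∀ x : H, braiding (1 ⊗ₜ[F] x) = x ⊗ₜ[F] 1
  /-- `β (id ⊗ η) = η ⊗ id` -/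
  braiding_one_right : ∀ x : H, braiding (x ⊗ₜ[F] 1) = 1 ⊗ₜ[F] x
  /-- `β (∇ ⊗ id) = (id ⊗ ∇)(β ⊗ id)(id ⊗ β)` -/
  braiding_mul_left :
    braiding.toLinearMap ∘ₗ (LinearMap.mul' F H).rTensor H =
    (LinearMap.mul' F H).lTensor H ∘ₗ (TensorProduct.assoc F H H H).toLinearMap ∘ₗ
      onFirst braiding.toLinearMap ∘ₗ onSecond braiding.toLinearMap
  /-- `β (id ⊗ ∇) = (∇ ⊗ id)(id ⊗ β)(β ⊗ id)` -/
  braiding_mul_right :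
    braiding.toLinearMap ∘ₗ (LinearMap.mul' F H).lTensor H ∘ₗ
      (TensorProduct.assoc F H H H).toLinearMap =
    (LinearMap.mul' F H).rTensor H ∘ₗ
      onSecond braiding.toLinearMap ∘ₗ onFirst braiding.toLinearMap
  /-- `(id ⊗ ε) β = ε ⊗ id` -/
  braiding_counit_left :
    (TensorProduct.rid F H).toLinearMap ∘ₗ counit.lTensor H ∘ₗ braiding.toLinearMap =
    (TensorProduct.lid F H).toLinearMap ∘ₗ counit.rTensor H
  /-- `(ε ⊗ id) β = id ⊗ ε` -/
  braiding_counit_right :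
    (TensorProduct.lid F H).toLinearMap ∘ₗ counit.rTensor H ∘ₗ braiding.toLinearMap =
    (TensorProduct.rid F H).toLinearMap ∘ₗ counit.lTensor H
  /-- `(id ⊗ Δ) β = (β ⊗ id)(id ⊗ β)(Δ ⊗ id)` -/
  braiding_comul_left :
    comul.lTensor H ∘ₗ braiding.toLinearMap =
    (TensorProduct.assoc F H H H).toLinearMap ∘ₗ
      onFirst braiding.toLinearMap ∘ₗ onSecond braiding.toLinearMap ∘ₗ comul.rTensor H
  /-- `(Δ ⊗ id) β = (id ⊗ β)(β ⊗ id)(id ⊗ Δ)` -/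
  braiding_comul_right :
    comul.rTensor H ∘ₗ braiding.toLinearMap =
    onSecond braiding.toLinearMap ∘ₗ onFirst braiding.toLinearMap ∘ₗ
      (TensorProduct.assoc F H H H).symm.toLinearMap ∘ₗ comul.lTensor H
  /-- `β (S ⊗ id) = (id ⊗ S) β` -/
  braiding_antipode_left :
    braiding.toLinearMap ∘ₗ antipode.rTensor H = antipode.lTensor H ∘ₗ braiding.toLinearMap
  /-- `β (id ⊗ S) = (S ⊗ id) β` -/
  braiding_antipode_right :
    braiding.toLinearMap ∘ₗ antipode.lTensor H = antipode.rTensor H ∘ₗ braiding.toLinearMap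
  /-- `ε` is unital -/
  counit_one : counit (1 : H) = 1
  /-- `ε` is multiplicative -/
  counit_mul : ∀ x y : H, counit (x * y) = counit x * counit y
  /-- `Δ` is unital -/
  comul_one : comul (1 : H) = 1 ⊗ₜ[F] 1
  /-- compatibility: `Δ ∇ = (∇ ⊗ ∇)(id ⊗ β ⊗ id)(Δ ⊗ Δ)` -/
  comul_mul :
    comul ∘ₗ LinearMap.mul' F H =
    TensorProduct.map (LinearMap.mul' F H) (LinearMap.mul' F H) ∘ₗ
      onMiddle braiding.toLinearMap ∘ₗ TensorProduct.map comul comul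
  /-- invertibility: `∇ (S ⊗ id) Δ = η ε` -/
  antipode_left :
    LinearMap.mul' F H ∘ₗ antipode.rTensor H ∘ₗ comul = Algebra.linearMap F H ∘ₗ counit
  /-- invertibility: `∇ (id ⊗ S) Δ = η ε` -/
  antipode_right :
    LinearMap.mul' F H ∘ₗ antipode.lTensor H ∘ₗ comul = Algebra.linearMap F H ∘ₗ counit

/-! ### The deformed exterior algebra -/

section Exterior

variable {F V I : Type*} [Field F] [AddCommGroup V] [Module F V] [LinearOrder I]

/-- The Heaviside symbol `θ_{a,b}`: it is `1` if `a > b` and `0` otherwise. -/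
def theta (a b : I) : ℕ := if b < a then 1 else 0

/-- `θ_{A,B} = ∑_{a ∈ A} ∑_{b ∈ B} θ_{a,b}`. -/
def thetaSet (A B : Finset I) : ℕ := ∑ a ∈ A, ∑ b ∈ B, theta a b

/-- The Hecke type braiding of `V` for the ordered basis `b` and the scalar `p`:
`τ(a ⊗ b) = (p ^ θ_{a,b} - 1) a ⊗ b - p ^ θ_{b,a} b ⊗ a` for basis vectors `a`, `b`. -/
def tau (𝔹 : Module.Basis I F V) (p : F) : V ⊗[F] V →ₗ[F] V ⊗[F] V :=
  (𝔹.tensorProduct 𝔹).constr F fun ab : I × I =>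
    (p ^ theta ab.1 ab.2 - 1) • (𝔹 ab.1 ⊗ₜ[F] 𝔹 ab.2) - p ^ theta ab.2 ab.1 • (𝔹 ab.2 ⊗ₜ[F] 𝔹 ab.1)

/-- A braided Hopf structure on the algebra `⋀ V` is that of `Λ_p(V)` if all elements of `V` are
primitive and its braiding is induced by `τ`, that is, restricts to `τ` on `V ⊗ V` (the
compatibility of the braiding with unit and product is part of `BraidedHopfStructure`). -/
structure IsLambda (𝔹 : Module.Basis I F V) (p : F)
    (L : BraidedHopfStructure F (ExteriorAlgebra F V)) : Prop where
  primitive : ∀ v : V, L.comul (ExteriorAlgebra.ι F v) =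
    ExteriorAlgebra.ι F v ⊗ₜ[F] 1 + 1 ⊗ₜ[F] ExteriorAlgebra.ι F v
  braiding_restrict : ∀ w : V ⊗[F] V,
    L.braiding (TensorProduct.map (ExteriorAlgebra.ι F) (ExteriorAlgebra.ι F) w) =
      TensorProduct.map (ExteriorAlgebra.ι F) (ExteriorAlgebra.ι F) (tau 𝔹 p w)

/-- `f_E = e₁ e₂ ⋯ e_k` in `⋀ V`, for `E = {e₁ < e₂ < ⋯ < e_k}`. -/
def word (𝔹 : Module.Basis I F V) (E : Finset I) : ExteriorAlgebra F V :=
  ((E.sort (· ≤ ·)).map fun i => ExteriorAlgebra.ι F (𝔹 i)).prod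

/-- The signed Gaussian exponential `(-1)^k p^{k(k-1)/2}`. -/
def signedGauss (p : F) (k : ℕ) : F := (-1) ^ k * p ^ (k * (k - 1) / 2)

end Exterior

end

end BraidedExterior

/-!
Why the deformed exterior algebra is the unique braided Hopf algebra over `τ`, and where its
structure constants come from.

Linear maps out of `⋀ V` are defined by the recursion `x ↦ v * x`: an action of `V` on a module `N`
in which every `v` has square zero, together with a value at `1`, gives a linear map `⋀ V → N`
(`CliffordAlgebra.foldr` for the zero form), and linear identities on `⋀ V` are proved by passing
from `x` to `v * x` (`left_induction`).

*Braiding.* Let `σ : V ⊗ W → W ⊗ V` be a crossing that satisfies the braid relation with `τ`. Then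
`V` acts on `W ⊗ ⋀ V` by crossing `W` and multiplying from the left. Acting twice with `v` sends
`v ⊗ v` through the product of `⋀ V`; this product factors through `1 + τ`, and `τ (v ⊗ v)` is
`-v ⊗ v`, so the square of the action is zero (`crossAct_crossAct`). Hence `σ` extends to
`⋀ V ⊗ W → W ⊗ ⋀ V` (`leftExtend`), and the mirror image extends `W ⊗ V → V ⊗ W` to
`W ⊗ ⋀ V → ⋀ V ⊗ W` (`rightExtend`). Extending `τ` first in its second and then in its first
variable gives `cross` and `braid`. The extensions of inverse crossings are inverse, so `braid` is
invertible. A map that commutes with the crossings by `V` commutes with the crossings by `⋀ V`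
(`IsExtension.natural`); applied to the product, the coproduct, the antipode, the counit and `braid`
itself, this gives half of the naturality axioms and the Yang-Baxter equation. The other half is a
direct left induction in the first variable.

*Coproduct and antipode.* The coproduct is defined by `Δ (v * x) = (v ⊗ 1 + 1 ⊗ v) * Δ x` in the
braided tensor square, where `(v ⊗ 1 + 1 ⊗ v) ^ 2 = 0`. Multiplicativity and coassociativity follow
by left induction. The Hecke relation gives `∇ τ = p ∇` on `V ⊗ V` (`mul_tau`); thus crossing `v`
past `x` and multiplying yields `v` times `scale p x`, in which degree `k` is multiplied by `p ^ k`
(`mul_cross`). The antipode is therefore `S (v * x) = -v * scale p (S x)`.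

*Uniqueness.* Compatibility with unit and product determines the braiding from its restriction to
`V ⊗ V`, primitivity of `V` determines the coproduct by the recursion above and forces the counit
to vanish on `V`, and the antipode is a convolution inverse.

*Words.* The words `f_E` are the standard basis of `⋀ V`. The formulas follow by peeling off the
least letter `a` of `E`: moving it past larger letters costs `-1` for each of them in the product
and `-p` for each of them in a crossing, and the antipode picks up `-p ^ (|E| - 1)`.
-/

/-! ### String calculus on right-nested tensor products -/

namespace BraidedExterior

noncomputable section

section Calculus

variable {F : Type*} [Field F]
variable {A B C D X Y M : Type*} [AddCommGroup A] [Module F A] [AddCommGroup B] [Module F B]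
  [AddCommGroup C] [Module F C] [AddCommGroup D] [Module F D] [AddCommGroup X] [Module F X]
  [AddCommGroup Y] [Module F Y] [AddCommGroup M] [Module F M]

/-- `f ⊗ id` for `f : A ⊗ B → C ⊗ D`, on right-nested tensor products. -/
def onHead (f : A ⊗[F] B →ₗ[F] C ⊗[F] D) (X : Type*) [AddCommGroup X] [Module F X] :
    A ⊗[F] (B ⊗[F] X) →ₗ[F] C ⊗[F] (D ⊗[F] X) :=
  (TensorProduct.assoc F C D X).toLinearMap ∘ₗ f.rTensor X ∘ₗ
    (TensorProduct.assoc F A B X).symm.toLinearMap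

/-- `f ⊗ id` for `f : A ⊗ B → C`, on right-nested tensor products. -/
def mergeHead (f : A ⊗[F] B →ₗ[F] C) (X : Type*) [AddCommGroup X] [Module F X] :
    A ⊗[F] (B ⊗[F] X) →ₗ[F] C ⊗[F] X :=
  f.rTensor X ∘ₗ (TensorProduct.assoc F A B X).symm.toLinearMap

/-- `a ↦ a ⊗ x`. -/
def tail (A : Type*) [AddCommGroup A] [Module F A] (x : X) : A →ₗ[F] A ⊗[F] X :=
  (TensorProduct.mk F A X).flip x

@[simp] lemma tail_apply (a : A) (x : X) : tail (F := F) A x a = a ⊗ₜ x := rfl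

lemma onHead_tmul (f : A ⊗[F] B →ₗ[F] C ⊗[F] D) (a : A) (b : B) (x : X) :
    onHead f X (a ⊗ₜ (b ⊗ₜ x)) = (tail D x).lTensor C (f (a ⊗ₜ b)) := by
  simp only [onHead, LinearMap.comp_apply, LinearEquiv.coe_coe, TensorProduct.assoc_symm_tmul,
    LinearMap.rTensor_tmul]
  induction f (a ⊗ₜ b) using TensorProduct.induction_on with
  | zero => simp
  | tmul c d => simp
  | add y z hy hz => simp only [map_add, TensorProduct.add_tmul, hy, hz]

@[simp] lemma mergeHead_tmul (f : A ⊗[F] B →ₗ[F] C) (a : A) (b : B) (x : X) :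
    mergeHead f X (a ⊗ₜ (b ⊗ₜ x)) = f (a ⊗ₜ b) ⊗ₜ x := by
  simp [mergeHead]

/-- Two linear maps on `A ⊗ (B ⊗ X)` agree if they agree after fixing the last factor. -/
lemma ext_tail₂ {φ ψ : A ⊗[F] (B ⊗[F] X) →ₗ[F] M}
    (h : ∀ (x : X) (y : A ⊗[F] B),
      φ ((tail B x).lTensor A y) = ψ ((tail B x).lTensor A y)) : φ = ψ := by
  ext a b x
  exact h x (a ⊗ₜ b)

/-- Two linear maps on `A ⊗ (B ⊗ (C ⊗ X))` agree if they agree after fixing the last factor. -/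
lemma ext_tail₃ {φ ψ : A ⊗[F] (B ⊗[F] (C ⊗[F] X)) →ₗ[F] M}
    (h : ∀ (x : X) (y : A ⊗[F] (B ⊗[F] C)),
      φ (((tail C x).lTensor B).lTensor A y) = ψ (((tail C x).lTensor B).lTensor A y)) :
    φ = ψ := by
  ext a b c x
  exact h x (a ⊗ₜ (b ⊗ₜ c))

lemma lTensor_congr {f g : A →ₗ[F] B} (h : ∀ x, f x = g x) (y : X ⊗[F] A) :
    f.lTensor X y = g.lTensor X y := by
  rw [LinearMap.ext h]

lemma rTensor_congr {f g : A →ₗ[F] B} (h : ∀ x, f x = g x) (y : A ⊗[F] X) :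
    f.rTensor X y = g.rTensor X y := by
  rw [LinearMap.ext h]

lemma onHead_tail (f : A ⊗[F] B →ₗ[F] C ⊗[F] D) (x : X) (y : A ⊗[F] B) :
    onHead f X ((tail B x).lTensor A y) = (tail D x).lTensor C (f y) := by
  induction y using TensorProduct.induction_on with
  | zero => simp
  | tmul a b => exact onHead_tmul f a b x
  | add y z hy hz => simp only [map_add, hy, hz]

lemma lTensor_onHead_tail (f : A ⊗[F] B →ₗ[F] C ⊗[F] D) (x : X) (y : Y ⊗[F] (A ⊗[F] B)) :
    (onHead f X).lTensor Y (((tail B x).lTensor A).lTensor Y y) =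
      ((tail D x).lTensor C).lTensor Y (f.lTensor Y y) := by
  rw [← LinearMap.lTensor_comp_apply, ← LinearMap.lTensor_comp_apply]
  exact lTensor_congr (fun y => onHead_tail f x y) y

lemma mergeHead_tail (f : A ⊗[F] B →ₗ[F] C) (x : X) (y : A ⊗[F] B) :
    mergeHead f X ((tail B x).lTensor A y) = f y ⊗ₜ x := by
  induction y using TensorProduct.induction_on with
  | zero => simp
  | tmul a b => exact mergeHead_tmul f a b x
  | add y z hy hz => simp only [map_add, hy, hz, TensorProduct.add_tmul]

lemma onHead_lTensor (f : A ⊗[F] B →ₗ[F] C ⊗[F] D) (k : X →ₗ[F] Y)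
    (z : A ⊗[F] (B ⊗[F] X)) :
    onHead f Y ((k.lTensor B).lTensor A z) = (k.lTensor D).lTensor C (onHead f X z) := by
  have : onHead f Y ∘ₗ (k.lTensor B).lTensor A = (k.lTensor D).lTensor C ∘ₗ onHead f X := by
    ext a b x
    simp only [TensorProduct.AlgebraTensorModule.curry_apply, LinearMap.restrictScalars_self,
      TensorProduct.curry_apply, LinearMap.comp_apply, LinearMap.lTensor_tmul, onHead_tmul]
    rw [← LinearMap.lTensor_comp_apply]
    rfl
  exact LinearMap.congr_fun this z

lemma mergeHead_lTensor (f : A ⊗[F] B →ₗ[F] C) (k : X →ₗ[F] Y) (z : A ⊗[F] (B ⊗[F] X)) :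
    mergeHead f Y ((k.lTensor B).lTensor A z) = k.lTensor C (mergeHead f X z) := by
  have : mergeHead f Y ∘ₗ (k.lTensor B).lTensor A = k.lTensor C ∘ₗ mergeHead f X := by
    ext a b x
    simp
  exact LinearMap.congr_fun this z

lemma rTensor_lTensor_comm (f : A →ₗ[F] B) (k : X →ₗ[F] Y) (z : A ⊗[F] X) :
    f.rTensor Y (k.lTensor A z) = k.lTensor B (f.rTensor X z) := by
  rw [← LinearMap.comp_apply, ← LinearMap.comp_apply, LinearMap.rTensor_comp_lTensor,
    LinearMap.lTensor_comp_rTensor]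

lemma onHead_onHead {A' B' : Type*} [AddCommGroup A'] [Module F A'] [AddCommGroup B'] [Module F B']
    (f : A ⊗[F] B →ₗ[F] C ⊗[F] D) (g : A' ⊗[F] B' →ₗ[F] A ⊗[F] B)
    (z : A' ⊗[F] (B' ⊗[F] X)) : onHead f X (onHead g X z) = onHead (f ∘ₗ g) X z := by
  simp [onHead, LinearMap.rTensor_comp]

@[simp] lemma onHead_id (z : A ⊗[F] (B ⊗[F] X)) :
    onHead (LinearMap.id : A ⊗[F] B →ₗ[F] A ⊗[F] B) X z = z := by
  simp [onHead]

end Calculus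

/-! ### Crossing the exterior algebra with a braided vector space -/

section Crossing

variable {F V : Type*} [Field F] [AddCommGroup V] [Module F V]

/-- Left multiplication `V ⊗ ⋀ V → ⋀ V`. -/
def leftMul (F V : Type*) [Field F] [AddCommGroup V] [Module F V] :
    V ⊗[F] ExteriorAlgebra F V →ₗ[F] ExteriorAlgebra F V :=
  LinearMap.mul' F (ExteriorAlgebra F V) ∘ₗ (ExteriorAlgebra.ι F).rTensor _

@[simp] lemma leftMul_tmul (v : V) (x : ExteriorAlgebra F V) :
    leftMul F V (v ⊗ₜ x) = ExteriorAlgebra.ι F v * x := by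
  simp [leftMul]

/-- To prove a linear statement about all of `⋀ V` it suffices to treat `1` and to pass from `x`
to `v * x` for `v` in `V`. -/
lemma left_induction {P : ExteriorAlgebra F V → Prop} (one : P 1)
    (smul : ∀ (r : F) x, P x → P (r • x))
    (add : ∀ x y, P x → P y → P (x + y))
    (ι_mul : ∀ v x, P x → P (ExteriorAlgebra.ι F v * x)) (x : ExteriorAlgebra F V) : P x :=
  CliffordAlgebra.left_induction (Q := (0 : QuadraticForm F V))
    (fun r => by rw [Algebra.algebraMap_eq_smul_one]; exact smul r 1 one) add
    (fun x v => ι_mul v x) x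

/-- Two linear maps on `⋀ V` agree if they agree at `1` and if agreement at `x` implies agreement
at `v * x` for all `v` in `V`. -/
lemma linearMap_ext {M : Type*} [AddCommGroup M] [Module F M]
    {φ ψ : ExteriorAlgebra F V →ₗ[F] M} (one : φ 1 = ψ 1)
    (ι_mul : ∀ v x, φ x = ψ x → φ (ExteriorAlgebra.ι F v * x) = ψ (ExteriorAlgebra.ι F v * x)) :
    φ = ψ :=
  LinearMap.ext fun x => left_induction (P := fun x => φ x = ψ x) one
    (fun r x h => by rw [map_smul, map_smul, h])
    (fun x y hx hy => by rw [map_add, map_add, hx, hy]) ι_mul x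

/-- The properties of a braiding `τ` of `V` under which it extends to the exterior algebra: it
satisfies the Yang-Baxter equation, squares `v ⊗ v` are eigenvectors for `-1`, and the product
`V ⊗ V → ⋀ V` factors through `1 + τ`. In every characteristic the last two conditions say that
`⋀ V` is the quotient of the tensor algebra by the ideal that the kernel of `1 + τ` generates. -/
structure IsExteriorBraiding (τ : V ⊗[F] V →ₗ[F] V ⊗[F] V) : Prop where
  yang_baxter : ∀ x : V ⊗[F] (V ⊗[F] V),
    onHead τ V (τ.lTensor V (onHead τ V x)) = τ.lTensor V (onHead τ V (τ.lTensor V x))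
  apply_self : ∀ v : V, τ (v ⊗ₜ v) = -(v ⊗ₜ v)
  factor : ∃ ρ : V ⊗[F] V →ₗ[F] ExteriorAlgebra F V, ∀ u v : V,
    ExteriorAlgebra.ι F u * ExteriorAlgebra.ι F v = ρ (u ⊗ₜ v + τ (u ⊗ₜ v))

variable {W : Type*} [AddCommGroup W] [Module F W]

/-- Compatibility of a crossing `σ : V ⊗ W → W ⊗ V` with `τ`: the braid relation on `V ⊗ V ⊗ W`. -/
def LeftCompatible (τ : V ⊗[F] V →ₗ[F] V ⊗[F] V) (σ : V ⊗[F] W →ₗ[F] W ⊗[F] V) : Prop :=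
  ∀ x : V ⊗[F] (V ⊗[F] W),
    τ.lTensor W (onHead σ V (σ.lTensor V x)) = onHead σ V (σ.lTensor V (onHead τ W x))

/-- Compatibility of a crossing `κ : W ⊗ V → V ⊗ W` with `τ`: the braid relation on `W ⊗ V ⊗ V`. -/
def RightCompatible (τ : V ⊗[F] V →ₗ[F] V ⊗[F] V) (κ : W ⊗[F] V →ₗ[F] V ⊗[F] W) : Prop :=
  ∀ x : W ⊗[F] (V ⊗[F] V),
    onHead τ W (κ.lTensor V (onHead κ V x)) = κ.lTensor V (onHead κ V (τ.lTensor W x))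

/-- The compatibility condition with a further tensor factor at the end. -/
lemma LeftCompatible.onTail {τ : V ⊗[F] V →ₗ[F] V ⊗[F] V} {σ : V ⊗[F] W →ₗ[F] W ⊗[F] V}
    (h : LeftCompatible τ σ) {X : Type*} [AddCommGroup X] [Module F X]
    (z : V ⊗[F] (V ⊗[F] (W ⊗[F] X))) :
    (onHead τ X).lTensor W (onHead σ (V ⊗[F] X) ((onHead σ X).lTensor V z)) =
      onHead σ (V ⊗[F] X) ((onHead σ X).lTensor V (onHead τ (W ⊗[F] X) z)) := by
  suffices H : (onHead τ X).lTensor W ∘ₗ onHead σ (V ⊗[F] X) ∘ₗ (onHead σ X).lTensor V =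
      onHead σ (V ⊗[F] X) ∘ₗ (onHead σ X).lTensor V ∘ₗ onHead τ (W ⊗[F] X) from
    LinearMap.congr_fun H z
  refine ext_tail₃ fun x y => ?_
  simp only [LinearMap.comp_apply]
  rw [onHead_lTensor, lTensor_onHead_tail, lTensor_onHead_tail, onHead_lTensor, onHead_lTensor,
    ← h y, lTensor_onHead_tail]

/-- `V` acts on `W ⊗ ⋀ V` by crossing `W` and multiplying from the left. -/
def crossAct (σ : V ⊗[F] W →ₗ[F] W ⊗[F] V) :
    V →ₗ[F] Module.End F (W ⊗[F] ExteriorAlgebra F V) :=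
  TensorProduct.curry ((leftMul F V).lTensor W ∘ₗ onHead σ (ExteriorAlgebra F V))

lemma crossAct_apply (σ : V ⊗[F] W →ₗ[F] W ⊗[F] V) (v : V) (z : W ⊗[F] ExteriorAlgebra F V) :
    crossAct σ v z = (leftMul F V).lTensor W (onHead σ (ExteriorAlgebra F V) (v ⊗ₜ z)) := rfl

/-- Two successive left multiplications see `u ⊗ v` only through `(1 + τ)(u ⊗ v)`. -/
lemma leftMul_leftMul_factor {τ : V ⊗[F] V →ₗ[F] V ⊗[F] V} (hτ : IsExteriorBraiding τ) :
    ∃ r : V ⊗[F] (V ⊗[F] ExteriorAlgebra F V) →ₗ[F] ExteriorAlgebra F V, ∀ z,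
      leftMul F V ((leftMul F V).lTensor V z) = r (z + onHead τ _ z) := by
  obtain ⟨ρ, hρ⟩ := hτ.factor
  refine ⟨LinearMap.mul' F _ ∘ₗ mergeHead ρ _, fun z => ?_⟩
  suffices H : leftMul F V ∘ₗ (leftMul F V).lTensor V =
      (LinearMap.mul' F _ ∘ₗ mergeHead ρ _) ∘ₗ (LinearMap.id + onHead τ _) from
    LinearMap.congr_fun H z
  refine ext_tail₂ fun x y => ?_
  simp only [LinearMap.comp_apply, LinearMap.add_apply, map_add, onHead_tail, mergeHead_tail,
    LinearMap.id_apply]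
  simp only [LinearMap.mul'_apply, ← add_mul, ← map_add]
  induction y using TensorProduct.induction_on with
  | zero => simp
  | tmul u v => simp [← hρ, mul_assoc]
  | add y z hy hz =>
    simp only [map_add, hy, hz] at *
    simp only [add_mul]
    abel

/-- Each `v` in `V` acts on `W ⊗ ⋀ V` with square zero, as the recursion over `⋀ V` requires: by
compatibility `τ` acts on the crossed `v ⊗ v` by `-1`, and the product factors through `1 + τ`. -/
lemma crossAct_crossAct {τ : V ⊗[F] V →ₗ[F] V ⊗[F] V} (hτ : IsExteriorBraiding τ)
    {σ : V ⊗[F] W →ₗ[F] W ⊗[F] V} (hσ : LeftCompatible τ σ) (v : V)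
    (z : W ⊗[F] ExteriorAlgebra F V) : crossAct σ v (crossAct σ v z) = 0 := by
  obtain ⟨r, hr⟩ := leftMul_leftMul_factor hτ
  rw [crossAct_apply, crossAct_apply, ← LinearMap.lTensor_tmul, ← LinearMap.lTensor_tmul,
    onHead_lTensor, ← LinearMap.lTensor_comp_apply]
  set Q := onHead σ (V ⊗[F] ExteriorAlgebra F V)
    ((onHead σ (ExteriorAlgebra F V)).lTensor V (v ⊗ₜ (v ⊗ₜ z))) with hQ
  have h1 : (onHead τ (ExteriorAlgebra F V)).lTensor W Q = -Q := by
    rw [hQ, hσ.onTail]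
    have : onHead τ (W ⊗[F] ExteriorAlgebra F V) (v ⊗ₜ (v ⊗ₜ z)) = -(v ⊗ₜ (v ⊗ₜ z)) := by
      rw [onHead_tmul, hτ.apply_self]; simp
    rw [this]; simp only [map_neg]
  have h2 : ∀ Q, (leftMul F V ∘ₗ (leftMul F V).lTensor V).lTensor W Q =
      r.lTensor W (Q + (onHead τ (ExteriorAlgebra F V)).lTensor W Q) := fun Q => by
    have : Q + (onHead τ (ExteriorAlgebra F V)).lTensor W Q =
        (LinearMap.id + onHead τ (ExteriorAlgebra F V)).lTensor W Q := by
      rw [LinearMap.lTensor_add, LinearMap.add_apply, LinearMap.lTensor_id_apply]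
    rw [this, ← LinearMap.lTensor_comp_apply]
    exact lTensor_congr (fun z => hr z) Q
  rw [h2, h1, add_neg_cancel, map_zero]

/-- The crossing `⋀ V ⊗ W → W ⊗ ⋀ V` induced by a crossing `σ : V ⊗ W → W ⊗ V`: the recursion
sends `1 ⊗ w` to `w ⊗ 1` and lets `v` act by `crossAct σ`. -/
def leftExtend {τ : V ⊗[F] V →ₗ[F] V ⊗[F] V} (hτ : IsExteriorBraiding τ)
    {σ : V ⊗[F] W →ₗ[F] W ⊗[F] V} (hσ : LeftCompatible τ σ) :
    ExteriorAlgebra F V ⊗[F] W →ₗ[F] W ⊗[F] ExteriorAlgebra F V :=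
  TensorProduct.lift (CliffordAlgebra.foldr (0 : QuadraticForm F V) (crossAct σ)
    (fun v z => by simpa using crossAct_crossAct hτ hσ v z) ∘ₗ tail W 1).flip

lemma leftExtend_one {τ : V ⊗[F] V →ₗ[F] V ⊗[F] V} (hτ : IsExteriorBraiding τ)
    {σ : V ⊗[F] W →ₗ[F] W ⊗[F] V} (hσ : LeftCompatible τ σ) (w : W) :
    leftExtend hτ hσ (1 ⊗ₜ w) = w ⊗ₜ 1 :=
  CliffordAlgebra.foldr_one 0 (crossAct σ)
    (fun v z => by simpa using crossAct_crossAct hτ hσ v z) (w ⊗ₜ 1)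

lemma leftExtend_ι_mul {τ : V ⊗[F] V →ₗ[F] V ⊗[F] V} (hτ : IsExteriorBraiding τ)
    {σ : V ⊗[F] W →ₗ[F] W ⊗[F] V} (hσ : LeftCompatible τ σ) (v : V) (x : ExteriorAlgebra F V)
    (w : W) : leftExtend hτ hσ ((ExteriorAlgebra.ι F v * x) ⊗ₜ w) =
      crossAct σ v (leftExtend hτ hσ (x ⊗ₜ w)) := by
  have hf : ∀ v z, crossAct σ v (crossAct σ v z) = (0 : QuadraticForm F V) v • z :=
    fun v z => by simpa using crossAct_crossAct hτ hσ v z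
  exact (CliffordAlgebra.foldr_mul 0 (crossAct σ) hf (w ⊗ₜ 1) _ x).trans
    (CliffordAlgebra.foldr_ι 0 (crossAct σ) hf _ v)

lemma leftExtend_mergeHead {τ : V ⊗[F] V →ₗ[F] V ⊗[F] V} (hτ : IsExteriorBraiding τ)
    {σ : V ⊗[F] W →ₗ[F] W ⊗[F] V} (hσ : LeftCompatible τ σ)
    (z : V ⊗[F] (ExteriorAlgebra F V ⊗[F] W)) :
    leftExtend hτ hσ (mergeHead (leftMul F V) W z) =
      (leftMul F V).lTensor W (onHead σ _ ((leftExtend hτ hσ).lTensor V z)) := by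
  suffices H : leftExtend hτ hσ ∘ₗ mergeHead (leftMul F V) W =
      (leftMul F V).lTensor W ∘ₗ onHead σ _ ∘ₗ (leftExtend hτ hσ).lTensor V from
    LinearMap.congr_fun H z
  refine TensorProduct.ext' fun v y => ?_
  induction y using TensorProduct.induction_on with
  | zero => simp
  | tmul x w => simpa [crossAct_apply] using leftExtend_ι_mul hτ hσ v x w
  | add y y' hy hy' => simp only [TensorProduct.tmul_add, map_add, hy, hy']

end Crossing
end
end BraidedExterior

/-! ### The mirror image construction -/

namespace BraidedExterior

noncomputable section

section RightCrossing

variable {F V : Type*} [Field F] [AddCommGroup V] [Module F V]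
variable {W : Type*} [AddCommGroup W] [Module F W]

/-- `V` acts on the linear maps `W → ⋀ V ⊗ W`: first cross `W` and `V`, then apply the given map
and multiply from the left. -/
def crossActHom (κ : W ⊗[F] V →ₗ[F] V ⊗[F] W) :
    V →ₗ[F] Module.End F (W →ₗ[F] ExteriorAlgebra F V ⊗[F] W) :=
  LinearMap.mk₂ F (fun v G => mergeHead (leftMul F V) W ∘ₗ G.lTensor V ∘ₗ κ ∘ₗ tail W v)
    (fun v v' G => by ext w; simp [TensorProduct.tmul_add])
    (fun r v G => by ext w; simp)
    (fun v G G' => by ext w; simp [LinearMap.lTensor_add])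
    (fun r v G => by ext w; simp [LinearMap.lTensor_smul])

lemma crossActHom_apply (κ : W ⊗[F] V →ₗ[F] V ⊗[F] W) (v : V)
    (G : W →ₗ[F] ExteriorAlgebra F V ⊗[F] W) (w : W) :
    crossActHom κ v G w = mergeHead (leftMul F V) W (G.lTensor V (κ (w ⊗ₜ v))) := rfl

/-- `leftMul_leftMul_factor` with a further tensor factor at the end. -/
lemma mergeHead_mergeHead_factor {τ : V ⊗[F] V →ₗ[F] V ⊗[F] V} (hτ : IsExteriorBraiding τ) :
    ∃ r : V ⊗[F] (V ⊗[F] (ExteriorAlgebra F V ⊗[F] W)) →ₗ[F] ExteriorAlgebra F V ⊗[F] W, ∀ z,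
      mergeHead (leftMul F V) W ((mergeHead (leftMul F V) W).lTensor V z) =
        r (z + onHead τ _ z) := by
  obtain ⟨r, hr⟩ := leftMul_leftMul_factor hτ
  refine ⟨r.rTensor W ∘ₗ (TensorProduct.assoc F V _ W).symm.toLinearMap ∘ₗ
    (TensorProduct.assoc F V _ W).symm.toLinearMap.lTensor V, fun z => ?_⟩
  generalize hR : r.rTensor W ∘ₗ (TensorProduct.assoc F V _ W).symm.toLinearMap ∘ₗ
    (TensorProduct.assoc F V _ W).symm.toLinearMap.lTensor V = R
  have hR' : ∀ (w : W) y, R (((tail _ w).lTensor V).lTensor V y) = r y ⊗ₜ w := fun w y => by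
    rw [← hR]
    simp only [LinearMap.comp_apply]
    rw [← LinearMap.lTensor_comp_apply,
      lTensor_congr (g := tail _ w) (fun y => ?_)]
    · exact mergeHead_tail r w y
    · induction y using TensorProduct.induction_on with
      | zero => simp
      | tmul a b => simp
      | add y z hy hz => simp only [map_add, hy, hz]
  suffices H : mergeHead (leftMul F V) W ∘ₗ (mergeHead (leftMul F V) W).lTensor V =
      R ∘ₗ (LinearMap.id + onHead τ _) from LinearMap.congr_fun H z
  refine ext_tail₃ fun w y => ?_
  simp only [LinearMap.comp_apply, LinearMap.add_apply, LinearMap.id_apply]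
  rw [onHead_lTensor, ← map_add, hR', ← hr, ← LinearMap.lTensor_comp_apply,
    lTensor_congr (g := tail _ w ∘ₗ leftMul F V) (fun y => mergeHead_tail _ w y),
    LinearMap.lTensor_comp_apply, mergeHead_tail]

/-- The action on linear maps has square zero, for the same reason as in `crossAct_crossAct`. -/
lemma crossActHom_crossActHom {τ : V ⊗[F] V →ₗ[F] V ⊗[F] V} (hτ : IsExteriorBraiding τ)
    {κ : W ⊗[F] V →ₗ[F] V ⊗[F] W} (hκ : RightCompatible τ κ) (v : V)
    (G : W →ₗ[F] ExteriorAlgebra F V ⊗[F] W) : crossActHom κ v (crossActHom κ v G) = 0 := by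
  obtain ⟨r, hr⟩ := mergeHead_mergeHead_factor (W := W) hτ
  ext w
  have e1 : crossActHom κ v G = mergeHead (leftMul F V) W ∘ₗ G.lTensor V ∘ₗ κ ∘ₗ tail W v := rfl
  rw [crossActHom_apply, e1]
  simp only [LinearMap.lTensor_comp, LinearMap.comp_apply]
  rw [← onHead_tmul]
  set Q := κ.lTensor V (onHead κ V (w ⊗ₜ (v ⊗ₜ v))) with hQ
  have h1 : onHead τ W Q = -Q := by
    rw [hQ, hκ, LinearMap.lTensor_tmul, hτ.apply_self]
    simp only [TensorProduct.tmul_neg, map_neg]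
  rw [hr, onHead_lTensor, h1, map_neg, add_neg_cancel, map_zero, LinearMap.zero_apply]

/-- The recursive extension of `crossActHom` to `⋀ V`. -/
def rightExtendHom {τ : V ⊗[F] V →ₗ[F] V ⊗[F] V} (hτ : IsExteriorBraiding τ)
    {κ : W ⊗[F] V →ₗ[F] V ⊗[F] W} (hκ : RightCompatible τ κ) :
    ExteriorAlgebra F V →ₗ[F] (W →ₗ[F] ExteriorAlgebra F V ⊗[F] W) :=
  CliffordAlgebra.foldr (0 : QuadraticForm F V) (crossActHom κ)
    (fun v G => (crossActHom_crossActHom hτ hκ v G).trans (by simp))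
    (TensorProduct.mk F (ExteriorAlgebra F V) W 1)

lemma rightExtendHom_one {τ : V ⊗[F] V →ₗ[F] V ⊗[F] V} (hτ : IsExteriorBraiding τ)
    {κ : W ⊗[F] V →ₗ[F] V ⊗[F] W} (hκ : RightCompatible τ κ) :
    rightExtendHom hτ hκ 1 = TensorProduct.mk F (ExteriorAlgebra F V) W 1 :=
  CliffordAlgebra.foldr_one (N := W →ₗ[F] ExteriorAlgebra F V ⊗[F] W) _ _ _ _

lemma rightExtendHom_ι_mul {τ : V ⊗[F] V →ₗ[F] V ⊗[F] V} (hτ : IsExteriorBraiding τ)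
    {κ : W ⊗[F] V →ₗ[F] V ⊗[F] W} (hκ : RightCompatible τ κ) (v : V) (x : ExteriorAlgebra F V) :
    rightExtendHom hτ hκ (ExteriorAlgebra.ι F v * x) =
      crossActHom κ v (rightExtendHom hτ hκ x) := by
  rw [rightExtendHom, CliffordAlgebra.foldr_mul, CliffordAlgebra.foldr_ι]

/-- The crossing `W ⊗ ⋀ V → ⋀ V ⊗ W` induced by a crossing `κ : W ⊗ V → V ⊗ W`. -/
def rightExtend {τ : V ⊗[F] V →ₗ[F] V ⊗[F] V} (hτ : IsExteriorBraiding τ)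
    {κ : W ⊗[F] V →ₗ[F] V ⊗[F] W} (hκ : RightCompatible τ κ) :
    W ⊗[F] ExteriorAlgebra F V →ₗ[F] ExteriorAlgebra F V ⊗[F] W :=
  TensorProduct.lift (rightExtendHom hτ hκ).flip

lemma rightExtend_tmul {τ : V ⊗[F] V →ₗ[F] V ⊗[F] V} (hτ : IsExteriorBraiding τ)
    {κ : W ⊗[F] V →ₗ[F] V ⊗[F] W} (hκ : RightCompatible τ κ) (w : W) (x : ExteriorAlgebra F V) :
    rightExtend hτ hκ (w ⊗ₜ x) = rightExtendHom hτ hκ x w := by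
  rw [rightExtend, TensorProduct.lift.tmul, LinearMap.flip_apply]

lemma rightExtend_one {τ : V ⊗[F] V →ₗ[F] V ⊗[F] V} (hτ : IsExteriorBraiding τ)
    {κ : W ⊗[F] V →ₗ[F] V ⊗[F] W} (hκ : RightCompatible τ κ) (w : W) :
    rightExtend hτ hκ (w ⊗ₜ 1) = 1 ⊗ₜ w := by
  rw [rightExtend_tmul, rightExtendHom_one, TensorProduct.mk_apply]

lemma rightExtend_ι_mul {τ : V ⊗[F] V →ₗ[F] V ⊗[F] V} (hτ : IsExteriorBraiding τ)
    {κ : W ⊗[F] V →ₗ[F] V ⊗[F] W} (hκ : RightCompatible τ κ) (w : W) (v : V)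
    (x : ExteriorAlgebra F V) :
    rightExtend hτ hκ (w ⊗ₜ (ExteriorAlgebra.ι F v * x)) =
      mergeHead (leftMul F V) W
        ((rightExtend hτ hκ).lTensor V (onHead κ _ (w ⊗ₜ (v ⊗ₜ x)))) := by
  rw [onHead_tmul, ← LinearMap.lTensor_comp_apply, rightExtend_tmul, rightExtendHom_ι_mul,
    crossActHom_apply]
  rfl

lemma rightExtend_lTensor {τ : V ⊗[F] V →ₗ[F] V ⊗[F] V} (hτ : IsExteriorBraiding τ)
    {κ : W ⊗[F] V →ₗ[F] V ⊗[F] W} (hκ : RightCompatible τ κ)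
    (z : W ⊗[F] (V ⊗[F] ExteriorAlgebra F V)) :
    rightExtend hτ hκ ((leftMul F V).lTensor W z) =
      mergeHead (leftMul F V) W ((rightExtend hτ hκ).lTensor V (onHead κ _ z)) := by
  suffices H : rightExtend hτ hκ ∘ₗ (leftMul F V).lTensor W =
      mergeHead (leftMul F V) W ∘ₗ (rightExtend hτ hκ).lTensor V ∘ₗ onHead κ _ from
    LinearMap.congr_fun H z
  refine TensorProduct.ext' fun w y => ?_
  induction y using TensorProduct.induction_on with
  | zero => simp
  | tmul v x => simpa using rightExtend_ι_mul hτ hκ w v x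
  | add y y' hy hy' => simp only [TensorProduct.tmul_add, map_add, hy, hy']

/-- Extensions of mutually inverse crossings are mutually inverse. The braidings `τ` and `τ'` of
`V` only serve to show that the recursions are well defined, so they need not be related. -/
lemma rightExtend_leftExtend {τ τ' : V ⊗[F] V →ₗ[F] V ⊗[F] V} (hτ : IsExteriorBraiding τ)
    (hτ' : IsExteriorBraiding τ')
    {σ : V ⊗[F] W →ₗ[F] W ⊗[F] V} (hσ : LeftCompatible τ σ)
    {κ : W ⊗[F] V →ₗ[F] V ⊗[F] W} (hκ : RightCompatible τ' κ)
    (hκσ : κ ∘ₗ σ = LinearMap.id) :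
    rightExtend hτ' hκ ∘ₗ leftExtend hτ hσ = LinearMap.id := by
  refine TensorProduct.ext ?_
  refine linearMap_ext (F := F) (V := V) (M := W →ₗ[F] ExteriorAlgebra F V ⊗[F] W) ?_ fun v x h => ?_
  · ext w
    simp [leftExtend_one, rightExtend_one]
  · ext w
    have h' := LinearMap.congr_fun h w
    simp only [LinearMap.compr₂ₛₗ_apply, LinearMap.comp_apply, TensorProduct.mk_apply,
      LinearMap.id_apply] at h' ⊢
    rw [leftExtend_ι_mul, crossAct_apply, rightExtend_lTensor, onHead_onHead, hκσ, onHead_id,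
      LinearMap.lTensor_tmul, h', mergeHead_tmul, leftMul_tmul]

lemma leftExtend_rightExtend {τ τ' : V ⊗[F] V →ₗ[F] V ⊗[F] V} (hτ : IsExteriorBraiding τ)
    (hτ' : IsExteriorBraiding τ')
    {σ : V ⊗[F] W →ₗ[F] W ⊗[F] V} (hσ : LeftCompatible τ σ)
    {κ : W ⊗[F] V →ₗ[F] V ⊗[F] W} (hκ : RightCompatible τ' κ)
    (hσκ : σ ∘ₗ κ = LinearMap.id) :
    leftExtend hτ hσ ∘ₗ rightExtend hτ' hκ = LinearMap.id := by
  suffices H : ∀ x, (leftExtend hτ hσ ∘ₗ rightExtend hτ' hκ) ∘ₗ tail W x = tail W x from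
    TensorProduct.ext' fun w x => LinearMap.congr_fun (H x) w
  intro x
  induction x using left_induction with
  | one =>
    ext w
    simp [leftExtend_one, rightExtend_one]
  | smul r x h =>
    ext w
    simpa using congrArg (r • ·) (LinearMap.congr_fun h w)
  | add x y hx hy =>
    ext w
    simpa [TensorProduct.tmul_add] using
      congrArg₂ (· + ·) (LinearMap.congr_fun hx w) (LinearMap.congr_fun hy w)
  | ι_mul v x h =>
    ext w
    simp only [LinearMap.comp_apply, tail_apply]
    rw [rightExtend_ι_mul, leftExtend_mergeHead, onHead_tmul, ← LinearMap.lTensor_comp_apply,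
      ← LinearMap.lTensor_comp_apply, h, ← onHead_tmul, onHead_onHead, hσκ, onHead_id,
      LinearMap.lTensor_tmul, leftMul_tmul]

end RightCrossing
end
end BraidedExterior

/-! ### The braiding of the exterior algebra -/

namespace BraidedExterior

noncomputable section

section Braiding

variable {F V : Type*} [Field F] [AddCommGroup V] [Module F V]
  {τ : V ⊗[F] V →ₗ[F] V ⊗[F] V}

lemma IsExteriorBraiding.leftCompatible (hτ : IsExteriorBraiding τ) : LeftCompatible τ τ :=
  fun x => (hτ.yang_baxter x).symm

lemma IsExteriorBraiding.rightCompatible (hτ : IsExteriorBraiding τ) : RightCompatible τ τ :=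
  hτ.yang_baxter

/-- The crossing `V ⊗ ⋀ V → ⋀ V ⊗ V` induced by `τ`. -/
def cross (hτ : IsExteriorBraiding τ) :
    V ⊗[F] ExteriorAlgebra F V →ₗ[F] ExteriorAlgebra F V ⊗[F] V :=
  rightExtend hτ hτ.rightCompatible

lemma cross_one (hτ : IsExteriorBraiding τ) (v : V) : cross hτ (v ⊗ₜ 1) = 1 ⊗ₜ v :=
  rightExtend_one ..

lemma cross_lTensor (hτ : IsExteriorBraiding τ) (z : V ⊗[F] (V ⊗[F] ExteriorAlgebra F V)) :
    cross hτ ((leftMul F V).lTensor V z) =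
      mergeHead (leftMul F V) V ((cross hτ).lTensor V (onHead τ _ z)) :=
  rightExtend_lTensor ..

/-- Crossing past `u * x` crosses `u` first and `x` second. -/
lemma cross_ι_mul (hτ : IsExteriorBraiding τ) (v u : V) (x : ExteriorAlgebra F V) :
    cross hτ (v ⊗ₜ (ExteriorAlgebra.ι F u * x)) =
      mergeHead (leftMul F V) V ((cross hτ).lTensor V (onHead τ _ (v ⊗ₜ (u ⊗ₜ x)))) :=
  rightExtend_ι_mul ..

/-- `cross_lTensor` with a further tensor factor at the end. -/
lemma onHead_cross_lTensor (hτ : IsExteriorBraiding τ) {X : Type*} [AddCommGroup X] [Module F X]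
    (z : V ⊗[F] (V ⊗[F] (ExteriorAlgebra F V ⊗[F] X))) :
    onHead (cross hτ) X ((mergeHead (leftMul F V) X).lTensor V z) =
      mergeHead (leftMul F V) (V ⊗[F] X)
        ((onHead (cross hτ) X).lTensor V (onHead τ _ z)) := by
  suffices H : onHead (cross hτ) X ∘ₗ (mergeHead (leftMul F V) X).lTensor V =
      mergeHead (leftMul F V) (V ⊗[F] X) ∘ₗ (onHead (cross hτ) X).lTensor V ∘ₗ onHead τ _ from
    LinearMap.congr_fun H z
  refine ext_tail₃ fun x y => ?_
  simp only [LinearMap.comp_apply]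
  rw [← LinearMap.lTensor_comp_apply,
    lTensor_congr (g := tail _ x ∘ₗ leftMul F V) (fun y => mergeHead_tail _ x y),
    LinearMap.lTensor_comp_apply, onHead_tail, cross_lTensor, ← mergeHead_lTensor, onHead_lTensor,
    lTensor_onHead_tail]

/-- The crossing `V ⊗ ⋀ V → ⋀ V ⊗ V` is again compatible with `τ`, so it extends to `⋀ V` in its
other variable. -/
lemma leftCompatible_cross (hτ : IsExteriorBraiding τ) : LeftCompatible τ (cross hτ) := by
  -- with the last factor `x` fixed, both sides are linear in `V ⊗ V`; induct on `x`
  suffices H : ∀ (x : ExteriorAlgebra F V) (y : V ⊗[F] V),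
      τ.lTensor _ (onHead (cross hτ) V ((cross hτ).lTensor V ((tail V x).lTensor V y))) =
        onHead (cross hτ) V ((cross hτ).lTensor V (onHead τ _ ((tail V x).lTensor V y))) by
    have : τ.lTensor _ ∘ₗ onHead (cross hτ) V ∘ₗ (cross hτ).lTensor V =
        onHead (cross hτ) V ∘ₗ (cross hτ).lTensor V ∘ₗ onHead τ _ := ext_tail₂ H
    exact LinearMap.congr_fun this
  intro x
  induction x using left_induction with
  | one =>
    have h1 : ∀ y : V ⊗[F] V, onHead (cross hτ) V
        ((cross hτ).lTensor V ((tail V 1).lTensor V y)) = 1 ⊗ₜ y := fun y => by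
      induction y using TensorProduct.induction_on with
      | zero => simp
      | tmul v w => simp [cross_one, onHead_tmul]
      | add y z hy hz => simp only [map_add, hy, hz, TensorProduct.tmul_add]
    intro y
    rw [onHead_tail, h1, h1, LinearMap.lTensor_tmul]
  | smul r x h =>
    intro y
    have : tail V (r • x) = r • tail (F := F) V x := by ext; simp
    simp only [this, LinearMap.lTensor_smul, LinearMap.smul_apply, map_smul, h]
  | add x x' h h' =>
    intro y
    have : tail V (x + x') = tail (F := F) V x + tail V x' := by
      ext; simp [TensorProduct.tmul_add]
    simp only [this, LinearMap.lTensor_add, LinearMap.add_apply, map_add, h, h']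
  | ι_mul u x h =>
    intro y
    have h2 : ∀ y : V ⊗[F] (V ⊗[F] V),
        (τ.lTensor _ ∘ₗ onHead (cross hτ) V ∘ₗ (cross hτ).lTensor V).lTensor V
          (((tail V x).lTensor V).lTensor V y) =
        (onHead (cross hτ) V ∘ₗ (cross hτ).lTensor V ∘ₗ onHead τ _).lTensor V
          (((tail V x).lTensor V).lTensor V y) := fun y => by
      rw [← LinearMap.lTensor_comp_apply, ← LinearMap.lTensor_comp_apply]
      exact lTensor_congr h y
    simp only [LinearMap.lTensor_comp_apply] at h2
    -- `key` computes a double crossing of the product `u * x`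
    have key : ∀ z : V ⊗[F] (V ⊗[F] (V ⊗[F] ExteriorAlgebra F V)),
        onHead (cross hτ) V ((cross hτ).lTensor V (((leftMul F V).lTensor V).lTensor V z)) =
        mergeHead (leftMul F V) (V ⊗[F] V) ((onHead (cross hτ) V).lTensor V
          (((cross hτ).lTensor V).lTensor V (onHead τ _ ((onHead τ _).lTensor V z)))) := fun z => by
      rw [← onHead_lTensor, ← onHead_cross_lTensor, ← LinearMap.lTensor_comp_apply,
        ← LinearMap.lTensor_comp_apply, ← LinearMap.lTensor_comp_apply]
      exact congrArg _ (lTensor_congr (fun z => cross_lTensor hτ z) z)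
    have h3 : ∀ y : V ⊗[F] V, (tail V (ExteriorAlgebra.ι F u * x)).lTensor V y =
        ((leftMul F V).lTensor V).lTensor V
          (((tail V x).lTensor V).lTensor V ((tail V u).lTensor V y)) := fun y => by
      rw [← LinearMap.lTensor_comp_apply, ← LinearMap.lTensor_comp_apply]
      exact lTensor_congr (fun v => by simp) y
    rw [h3, onHead_lTensor, key, key, ← mergeHead_lTensor, lTensor_onHead_tail, onHead_lTensor, h2,
      onHead_lTensor, lTensor_onHead_tail, lTensor_onHead_tail, onHead_lTensor, hτ.yang_baxter]

/-- The inverse of an extendable braiding is extendable. -/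
lemma IsExteriorBraiding.symm {τ τ' : V ⊗[F] V →ₗ[F] V ⊗[F] V} (hτ : IsExteriorBraiding τ)
    (h : τ ∘ₗ τ' = LinearMap.id) (h' : τ' ∘ₗ τ = LinearMap.id) : IsExteriorBraiding τ' := by
  have hh : ∀ x, τ (τ' x) = x := fun x => LinearMap.congr_fun h x
  have hh' : ∀ x, τ' (τ x) = x := fun x => LinearMap.congr_fun h' x
  refine ⟨fun x => ?_, fun v => ?_, ?_⟩
  · have a1 : ∀ x : V ⊗[F] (V ⊗[F] V), onHead τ V (onHead τ' V x) = x := fun x => by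
      rw [onHead_onHead, h, onHead_id]
    have a2 : ∀ x : V ⊗[F] (V ⊗[F] V), onHead τ' V (onHead τ V x) = x := fun x => by
      rw [onHead_onHead, h', onHead_id]
    have b1 : ∀ x : V ⊗[F] (V ⊗[F] V), τ.lTensor V (τ'.lTensor V x) = x := fun x => by
      rw [← LinearMap.lTensor_comp_apply, h, LinearMap.lTensor_id_apply]
    have b2 : ∀ x : V ⊗[F] (V ⊗[F] V), τ'.lTensor V (τ.lTensor V x) = x := fun x => by
      rw [← LinearMap.lTensor_comp_apply, h', LinearMap.lTensor_id_apply]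
    have := hτ.yang_baxter (onHead τ' V (τ'.lTensor V (onHead τ' V x)))
    rw [a1, b1, a1] at this
    have := congrArg (fun z => τ'.lTensor V (onHead τ' V (τ'.lTensor V z))) this
    simp only [b2, a2] at this
    exact this.symm
  · have := hh' (v ⊗ₜ v)
    rw [hτ.apply_self, map_neg] at this
    rw [← this, neg_neg, this]
  · obtain ⟨ρ, hρ⟩ := hτ.factor
    refine ⟨ρ ∘ₗ τ, fun u v => ?_⟩
    rw [hρ, LinearMap.comp_apply, map_add τ, hh, add_comm]

/-- The inverse of a crossing compatible with `τ` is compatible with the inverse of `τ`. -/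
lemma LeftCompatible.rightCompatible_symm {W : Type*} [AddCommGroup W] [Module F W]
    {τ τ' : V ⊗[F] V →ₗ[F] V ⊗[F] V}
    {σ : V ⊗[F] W →ₗ[F] W ⊗[F] V} {κ : W ⊗[F] V →ₗ[F] V ⊗[F] W} (hσ : LeftCompatible τ σ)
    (h : τ ∘ₗ τ' = LinearMap.id) (h' : τ' ∘ₗ τ = LinearMap.id)
    (k : σ ∘ₗ κ = LinearMap.id) (k' : κ ∘ₗ σ = LinearMap.id) : RightCompatible τ' κ := by
  intro x
  have := hσ (onHead τ' W (κ.lTensor V (onHead κ V x)))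
  rw [onHead_onHead, h, onHead_id, ← LinearMap.lTensor_comp_apply, k, LinearMap.lTensor_id_apply,
    onHead_onHead, k, onHead_id] at this
  have := congrArg (fun z => κ.lTensor V (onHead κ V (τ'.lTensor W z))) this
  have c : ∀ z : W ⊗[F] (V ⊗[F] V), τ'.lTensor W (τ.lTensor W z) = z := fun z => by
    rw [← LinearMap.lTensor_comp_apply, h', LinearMap.lTensor_id_apply]
  rw [c, onHead_onHead, k', onHead_id, ← LinearMap.lTensor_comp_apply, k',
    LinearMap.lTensor_id_apply] at this
  exact this

/-- The braiding of `⋀ V` induced by `τ`: the extension of `cross` in its first variable. -/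
def braid (hτ : IsExteriorBraiding τ) :
    ExteriorAlgebra F V ⊗[F] ExteriorAlgebra F V →ₗ[F]
      ExteriorAlgebra F V ⊗[F] ExteriorAlgebra F V :=
  leftExtend hτ (leftCompatible_cross hτ)

lemma exists_cross_inverse (hτ : IsExteriorBraiding τ) {τ' : V ⊗[F] V →ₗ[F] V ⊗[F] V}
    (h : τ ∘ₗ τ' = LinearMap.id) (h' : τ' ∘ₗ τ = LinearMap.id) :
    ∃ κ : ExteriorAlgebra F V ⊗[F] V →ₗ[F] V ⊗[F] ExteriorAlgebra F V,
      cross hτ ∘ₗ κ = LinearMap.id ∧ κ ∘ₗ cross hτ = LinearMap.id :=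
  ⟨leftExtend (hτ.symm h h') (hτ.symm h h').leftCompatible,
    rightExtend_leftExtend _ _ _ _ h, leftExtend_rightExtend _ _ _ _ h'⟩

lemma exists_braid_inverse (hτ : IsExteriorBraiding τ) {τ' : V ⊗[F] V →ₗ[F] V ⊗[F] V}
    (h : τ ∘ₗ τ' = LinearMap.id) (h' : τ' ∘ₗ τ = LinearMap.id) :
    ∃ β : ExteriorAlgebra F V ⊗[F] ExteriorAlgebra F V →ₗ[F]
        ExteriorAlgebra F V ⊗[F] ExteriorAlgebra F V,
      braid hτ ∘ₗ β = LinearMap.id ∧ β ∘ₗ braid hτ = LinearMap.id := by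
  obtain ⟨κ, k, k'⟩ := exists_cross_inverse hτ h h'
  exact ⟨rightExtend (hτ.symm h h') ((leftCompatible_cross hτ).rightCompatible_symm h h' k k'),
    leftExtend_rightExtend _ _ _ _ k, rightExtend_leftExtend _ _ _ _ k'⟩

end Braiding
end
end BraidedExterior

/-! ### Naturality of the braiding -/

namespace BraidedExterior

noncomputable section

section Naturality

variable {F V : Type*} [Field F] [AddCommGroup V] [Module F V]
  {τ : V ⊗[F] V →ₗ[F] V ⊗[F] V}
variable {A W W' : Type*} [AddCommGroup A] [Module F A] [AddCommGroup W] [Module F W]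
  [AddCommGroup W'] [Module F W']

/-- Naturality of crossings with a further tensor factor at the end. -/
lemma onHead_rTensor {X : Type*} [AddCommGroup X] [Module F X]
    {σ : A ⊗[F] W →ₗ[F] W ⊗[F] A} {σ' : A ⊗[F] W' →ₗ[F] W' ⊗[F] A} {f : W →ₗ[F] W'}
    (hf : ∀ y, σ' (f.lTensor A y) = f.rTensor A (σ y)) (z : A ⊗[F] (W ⊗[F] X)) :
    onHead σ' X ((f.rTensor X).lTensor A z) = f.rTensor (A ⊗[F] X) (onHead σ X z) := by
  suffices H : onHead σ' X ∘ₗ (f.rTensor X).lTensor A = f.rTensor (A ⊗[F] X) ∘ₗ onHead σ X from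
    LinearMap.congr_fun H z
  refine ext_tail₂ fun x y => ?_
  simp only [LinearMap.comp_apply]
  rw [onHead_tail, rTensor_lTensor_comm, ← hf, ← onHead_tail, ← LinearMap.lTensor_comp_apply,
    ← LinearMap.lTensor_comp_apply]
  rfl

/-- Crossing two objects one after the other. -/
def doubleCross (f : A ⊗[F] W →ₗ[F] W ⊗[F] A) (g : A ⊗[F] W' →ₗ[F] W' ⊗[F] A) :
    A ⊗[F] (W ⊗[F] W') →ₗ[F] (W ⊗[F] W') ⊗[F] A :=
  (TensorProduct.assoc F W W' A).symm.toLinearMap ∘ₗ g.lTensor W ∘ₗ onHead f W'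

/-- `b : ⋀ V ⊗ W → W ⊗ ⋀ V` is the multiplicative extension of `σ : V ⊗ W → W ⊗ V`. -/
structure IsExtension (σ : V ⊗[F] W →ₗ[F] W ⊗[F] V)
    (b : ExteriorAlgebra F V ⊗[F] W →ₗ[F] W ⊗[F] ExteriorAlgebra F V) : Prop where
  one : ∀ w, b (1 ⊗ₜ w) = w ⊗ₜ 1
  ι_mul : ∀ v x w, b ((ExteriorAlgebra.ι F v * x) ⊗ₜ w) = crossAct σ v (b (x ⊗ₜ w))

lemma IsExtension.mergeHead {σ : V ⊗[F] W →ₗ[F] W ⊗[F] V}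
    {b : ExteriorAlgebra F V ⊗[F] W →ₗ[F] W ⊗[F] ExteriorAlgebra F V} (hb : IsExtension σ b)
    (z : V ⊗[F] (ExteriorAlgebra F V ⊗[F] W)) :
    b (mergeHead (leftMul F V) W z) =
      (leftMul F V).lTensor W (onHead σ _ (b.lTensor V z)) := by
  suffices H : b ∘ₗ BraidedExterior.mergeHead (leftMul F V) W =
      (leftMul F V).lTensor W ∘ₗ onHead σ _ ∘ₗ b.lTensor V from
    LinearMap.congr_fun H z
  refine TensorProduct.ext' fun v y => ?_
  induction y using TensorProduct.induction_on with
  | zero => simp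
  | tmul x w => simpa [crossAct_apply] using hb.ι_mul v x w
  | add y y' hy hy' => simp only [TensorProduct.tmul_add, map_add, hy, hy']

lemma IsExtension.onHead_mergeHead {X : Type*} [AddCommGroup X] [Module F X]
    {σ : V ⊗[F] W →ₗ[F] W ⊗[F] V}
    {b : ExteriorAlgebra F V ⊗[F] W →ₗ[F] W ⊗[F] ExteriorAlgebra F V} (hb : IsExtension σ b)
    (z : V ⊗[F] (ExteriorAlgebra F V ⊗[F] (W ⊗[F] X))) :
    onHead b X (BraidedExterior.mergeHead (leftMul F V) (W ⊗[F] X) z) =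
      (BraidedExterior.mergeHead (leftMul F V) X).lTensor W
        (onHead σ _ ((onHead b X).lTensor V z)) := by
  suffices H : onHead b X ∘ₗ BraidedExterior.mergeHead (leftMul F V) (W ⊗[F] X) =
      (BraidedExterior.mergeHead (leftMul F V) X).lTensor W ∘ₗ onHead σ _ ∘ₗ
        (onHead b X).lTensor V from LinearMap.congr_fun H z
  refine ext_tail₃ fun x y => ?_
  simp only [LinearMap.comp_apply]
  rw [mergeHead_lTensor, onHead_tail, hb.mergeHead, lTensor_onHead_tail, onHead_lTensor,
    ← LinearMap.lTensor_comp_apply, ← LinearMap.lTensor_comp_apply]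
  exact lTensor_congr (fun y => (mergeHead_tail _ x y).symm) _

lemma isExtension_braid (hτ : IsExteriorBraiding τ) : IsExtension (cross hτ) (braid hτ) :=
  ⟨leftExtend_one _ _, leftExtend_ι_mul _ _⟩

/-- The ground field is crossed by the flip. -/
lemma isExtension_comm : IsExtension (TensorProduct.comm F V F).toLinearMap
    (TensorProduct.comm F (ExteriorAlgebra F V) F).toLinearMap where
  one w := by simp
  ι_mul v x w := by simp [crossAct_apply, onHead_tmul]

lemma crossAct_doubleCross (σ : V ⊗[F] W →ₗ[F] W ⊗[F] V) (σ' : V ⊗[F] W' →ₗ[F] W' ⊗[F] V) (v : V)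
    (z : W ⊗[F] (W' ⊗[F] ExteriorAlgebra F V)) :
    crossAct (doubleCross σ σ') v ((TensorProduct.assoc F W W' _).symm z) =
      (TensorProduct.assoc F W W' _).symm (((leftMul F V).lTensor W').lTensor W
        ((onHead σ' (ExteriorAlgebra F V)).lTensor W (onHead σ _ (v ⊗ₜ z)))) := by
  suffices H : ∀ y : V ⊗[F] (W ⊗[F] (W' ⊗[F] ExteriorAlgebra F V)),
      (leftMul F V).lTensor (W ⊗[F] W') (onHead (doubleCross σ σ') _
        ((TensorProduct.assoc F W W' _).symm.toLinearMap.lTensor V y)) =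
      (TensorProduct.assoc F W W' _).symm (((leftMul F V).lTensor W').lTensor W
      ((onHead σ' (ExteriorAlgebra F V)).lTensor W (onHead σ _ y))) from H (v ⊗ₜ z)
  intro y
  suffices H : (leftMul F V).lTensor (W ⊗[F] W') ∘ₗ (onHead (doubleCross σ σ') _ ∘ₗ
        (TensorProduct.assoc F W W' _).symm.toLinearMap.lTensor V) =
      (TensorProduct.assoc F W W' _).symm.toLinearMap ∘ₗ ((leftMul F V).lTensor W').lTensor W ∘ₗ
      ((onHead σ' (ExteriorAlgebra F V)).lTensor W ∘ₗ onHead σ _) from LinearMap.congr_fun H y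
  refine ext_tail₃ fun x y => ?_
  simp only [LinearMap.comp_apply, LinearEquiv.coe_coe]
  have e1 : (TensorProduct.assoc F W W' (ExteriorAlgebra F V)).symm.toLinearMap.lTensor V
      (((tail W' x).lTensor W).lTensor V y) = (tail (W ⊗[F] W') x).lTensor V y := by
    rw [← LinearMap.lTensor_comp_apply]
    refine lTensor_congr (fun y => ?_) y
    induction y using TensorProduct.induction_on with
    | zero => simp
    | tmul a b => simp
    | add y z hy hz => simp only [map_add, hy, hz]
  rw [e1, onHead_tail, onHead_lTensor, ← LinearMap.lTensor_comp_apply W _ (onHead σ' _),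
    ← LinearMap.lTensor_comp_apply, doubleCross]
  simp only [LinearMap.comp_apply, LinearEquiv.coe_coe]
  generalize onHead σ W' y = t
  induction t using TensorProduct.induction_on with
  | zero => simp
  | add y z hy hz => simp only [map_add, hy, hz]
  | tmul a s =>
    simp only [LinearMap.lTensor_tmul, LinearMap.comp_apply, onHead_tail]
    generalize σ' s = s'
    induction s' using TensorProduct.induction_on with
    | zero => simp
    | add y z hy hz => simp only [map_add, hy, hz, TensorProduct.tmul_add]
    | tmul c d => simp

/-- Crossings of `⋀ V` with `W` and with `W'` compose to the extension of the composite crossing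
with `W ⊗ W'`. -/
lemma IsExtension.double {σ : V ⊗[F] W →ₗ[F] W ⊗[F] V}
    {b : ExteriorAlgebra F V ⊗[F] W →ₗ[F] W ⊗[F] ExteriorAlgebra F V} (hb : IsExtension σ b)
    {σ' : V ⊗[F] W' →ₗ[F] W' ⊗[F] V}
    {b' : ExteriorAlgebra F V ⊗[F] W' →ₗ[F] W' ⊗[F] ExteriorAlgebra F V}
    (hb' : IsExtension σ' b') : IsExtension (doubleCross σ σ') (doubleCross b b') := by
  constructor
  · intro y
    induction y using TensorProduct.induction_on with
    | zero => simp
    | tmul w w' => simp [doubleCross, onHead_tmul, hb.one, hb'.one]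
    | add y y' hy hy' => simp only [TensorProduct.tmul_add, map_add, hy, hy', TensorProduct.add_tmul]
  · intro v x y
    have e2 : ∀ x y, doubleCross b b' (x ⊗ₜ y) =
      (TensorProduct.assoc F W W' _).symm (b'.lTensor W (onHead b W' (x ⊗ₜ y))) := fun _ _ => rfl
    have e3 : (ExteriorAlgebra.ι F v * x) ⊗ₜ y =
        BraidedExterior.mergeHead (leftMul F V) (W ⊗[F] W') (v ⊗ₜ (x ⊗ₜ y)) := by simp
    rw [e2, e2, crossAct_doubleCross, e3, hb.onHead_mergeHead, ← LinearMap.lTensor_comp_apply,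
      lTensor_congr (g := (leftMul F V).lTensor W' ∘ₗ onHead σ' _ ∘ₗ b'.lTensor V)
        (fun z => hb'.mergeHead z), LinearMap.lTensor_comp_apply W,
      LinearMap.lTensor_comp_apply W, ← onHead_lTensor, LinearMap.lTensor_tmul,
      LinearMap.lTensor_tmul]

/-- A map that commutes with the crossings by `V` commutes with the crossings by `⋀ V`. -/
lemma IsExtension.natural {σ : V ⊗[F] W →ₗ[F] W ⊗[F] V}
    {b : ExteriorAlgebra F V ⊗[F] W →ₗ[F] W ⊗[F] ExteriorAlgebra F V} (hb : IsExtension σ b)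
    {σ' : V ⊗[F] W' →ₗ[F] W' ⊗[F] V}
    {b' : ExteriorAlgebra F V ⊗[F] W' →ₗ[F] W' ⊗[F] ExteriorAlgebra F V}
    (hb' : IsExtension σ' b') {f : W →ₗ[F] W'}
    (hf : ∀ y, σ' (f.lTensor V y) = f.rTensor V (σ y)) :
    b' ∘ₗ f.lTensor _ = f.rTensor _ ∘ₗ b := by
  refine TensorProduct.ext' fun x w => ?_
  simp only [LinearMap.comp_apply, LinearMap.lTensor_tmul]
  induction x using left_induction with
  | one => simp [hb.one, hb'.one]
  | smul r x h => simp only [← TensorProduct.smul_tmul', map_smul, h]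
  | add x y hx hy => simp only [TensorProduct.add_tmul, map_add, hx, hy]
  | ι_mul v x h =>
    rw [hb.ι_mul, hb'.ι_mul, h, crossAct_apply, crossAct_apply, rTensor_lTensor_comm,
      ← onHead_rTensor hf, LinearMap.lTensor_tmul]

/-! ### Crossings commute with the product and the braiding -/

/-- Crossing `v` past a product is crossing it past the factors in turn. -/
lemma cross_mul (hτ : IsExteriorBraiding τ) (y : V ⊗[F] (ExteriorAlgebra F V ⊗[F]
      ExteriorAlgebra F V)) :
    cross hτ ((LinearMap.mul' F _).lTensor V y) =
      (LinearMap.mul' F _).rTensor V (doubleCross (cross hτ) (cross hτ) y) := by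
  suffices H : ∀ x (y : V ⊗[F] ExteriorAlgebra F V),
      cross hτ ((LinearMap.mulLeft F x).lTensor V y) =
        mergeHead (LinearMap.mul' F _) V ((cross hτ).lTensor _
          (onHead (cross hτ) _ ((TensorProduct.mk F _ _ x).lTensor V y))) by
    suffices H' : cross hτ ∘ₗ (LinearMap.mul' F _).lTensor V =
      (LinearMap.mul' F _).rTensor V ∘ₗ doubleCross (cross hτ) (cross hτ) from
      LinearMap.congr_fun H' y
    refine TensorProduct.ext' fun v y => ?_
    induction y using TensorProduct.induction_on with
    | zero => simp
    | add y y' hy hy' => simp only [TensorProduct.tmul_add, map_add, hy, hy']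
    | tmul x z => simpa [mergeHead, doubleCross] using H x (v ⊗ₜ z)
  intro x
  induction x using left_induction with
  | one =>
    intro y
    induction y using TensorProduct.induction_on with
    | zero => simp
    | add y y' hy hy' => simp only [map_add, hy, hy']
    | tmul v z =>
      simp only [LinearMap.lTensor_tmul, LinearMap.mulLeft_apply, one_mul, TensorProduct.mk_apply,
        onHead_tmul, cross_one, tail_apply]
      generalize cross hτ (v ⊗ₜ z) = t
      induction t using TensorProduct.induction_on with
      | zero => simp
      | add y y' hy hy' => simp only [TensorProduct.tmul_add, map_add, ← hy, ← hy']
      | tmul a b => simp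
  | smul r x h =>
    intro y
    have e1 : LinearMap.mulLeft F (r • x) = r • LinearMap.mulLeft F x := by ext; simp
    simp only [e1, map_smul, LinearMap.lTensor_smul, LinearMap.smul_apply, h]
  | add x x' h h' =>
    intro y
    have e1 : LinearMap.mulLeft F (x + x') = LinearMap.mulLeft F x + LinearMap.mulLeft F x' := by
      ext; simp [add_mul]
    simp only [e1, map_add, LinearMap.lTensor_add, LinearMap.add_apply, h, h']
  | ι_mul u x h =>
    intro y
    induction y using TensorProduct.induction_on with
    | zero => simp
    | add y y' hy hy' => simp only [map_add, hy, hy']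
    | tmul v z =>
      have e1 : v ⊗ₜ[F] ((ExteriorAlgebra.ι F u * x) ⊗ₜ[F] z) =
        (mergeHead (leftMul F V) _).lTensor V (v ⊗ₜ (u ⊗ₜ (x ⊗ₜ z))) := by simp
      simp only [LinearMap.lTensor_tmul, LinearMap.mulLeft_apply, mul_assoc, cross_ι_mul,
        TensorProduct.mk_apply]
      rw [e1, onHead_cross_lTensor, onHead_tmul, onHead_tmul]
      generalize τ (v ⊗ₜ u) = t
      induction t using TensorProduct.induction_on with
      | zero => simp
      | add y y' hy hy' => simp only [map_add, hy, hy']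
      | tmul c w =>
        have h1 := h (w ⊗ₜ z)
        simp only [LinearMap.lTensor_tmul, LinearMap.mulLeft_apply, tail_apply,
          TensorProduct.mk_apply] at h1 ⊢
        rw [h1]
        generalize onHead (cross hτ) _ (w ⊗ₜ (x ⊗ₜ z)) = s
        induction s using TensorProduct.induction_on with
        | zero => simp
        | add y y' hy hy' => simp only [TensorProduct.tmul_add, map_add, hy, hy']
        | tmul a s' =>
          simp only [mergeHead_tmul, LinearMap.lTensor_tmul]
          generalize cross hτ s' = s''
          induction s'' using TensorProduct.induction_on with
          | zero => simp
          | add y y' hy hy' => simp only [TensorProduct.tmul_add, map_add, hy, hy']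
          | tmul b w' => simp [mul_assoc]

/-- Pulling `v` past `β(g ⊗ h)` is the same as pulling it past `g ⊗ h` and braiding afterwards. -/
lemma cross_braid (hτ : IsExteriorBraiding τ) (y : V ⊗[F] (ExteriorAlgebra F V ⊗[F]
      ExteriorAlgebra F V)) :
    doubleCross (cross hτ) (cross hτ) ((braid hτ).lTensor V y) =
      (braid hτ).rTensor V (doubleCross (cross hτ) (cross hτ) y) := by
  have hb := isExtension_braid hτ
  suffices H : ∀ g h v, (cross hτ).lTensor _ (onHead (cross hτ) _ (v ⊗ₜ braid hτ (g ⊗ₜ h))) =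
      onHead (braid hτ) V ((cross hτ).lTensor _ (onHead (cross hτ) _ (v ⊗ₜ (g ⊗ₜ h)))) by
    suffices H' : doubleCross (cross hτ) (cross hτ) ∘ₗ (braid hτ).lTensor V =
      (braid hτ).rTensor V ∘ₗ doubleCross (cross hτ) (cross hτ) from
      LinearMap.congr_fun H' y
    refine TensorProduct.ext' fun v y => ?_
    induction y using TensorProduct.induction_on with
    | zero => simp
    | add y y' hy hy' => simp only [TensorProduct.tmul_add, map_add, hy, hy']
    | tmul g h =>
      simp only [doubleCross, LinearMap.comp_apply, LinearMap.lTensor_tmul, H, LinearEquiv.coe_coe]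
      simp [onHead]
  intro g h
  induction g using left_induction with
  | one =>
    intro v
    rw [hb.one, onHead_tmul, onHead_tmul, cross_one, ← LinearMap.lTensor_comp_apply,
      LinearMap.lTensor_tmul, LinearMap.lTensor_tmul, tail_apply]
    generalize cross hτ (v ⊗ₜ h) = t
    induction t using TensorProduct.induction_on with
    | zero => simp
    | add y y' hy hy' => simp only [TensorProduct.tmul_add, map_add, hy, hy']
    | tmul a b => simp [cross_one, onHead_tmul, hb.one]
  | smul r x ih =>
    intro v
    simp only [← TensorProduct.smul_tmul', TensorProduct.tmul_smul, map_smul, ih]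
  | add x x' ih ih' =>
    intro v
    simp only [TensorProduct.add_tmul, TensorProduct.tmul_add, map_add, ih, ih']
  | ι_mul u g ih =>
    intro v
    have e1 : v ⊗ₜ[F] ((ExteriorAlgebra.ι F u * g) ⊗ₜ[F] h) =
        (mergeHead (leftMul F V) _).lTensor V (v ⊗ₜ (u ⊗ₜ (g ⊗ₜ h))) := by simp
    have e2 : v ⊗ₜ[F] braid hτ ((ExteriorAlgebra.ι F u * g) ⊗ₜ[F] h) =
        ((leftMul F V).lTensor _).lTensor V ((onHead (cross hτ) _).lTensor V
          (v ⊗ₜ (u ⊗ₜ braid hτ (g ⊗ₜ h)))) := by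
      rw [hb.ι_mul]; rfl
    have e3 : v ⊗ₜ[F] (u ⊗ₜ[F] braid hτ (g ⊗ₜ h)) =
        ((braid hτ).lTensor V).lTensor V (v ⊗ₜ (u ⊗ₜ (g ⊗ₜ h))) := rfl
    have e4 : ∀ z : V ⊗[F] V, ((cross hτ).lTensor _).lTensor V ((onHead (cross hτ) _).lTensor V
          (((braid hτ).lTensor V).lTensor V ((tail V (g ⊗ₜ h)).lTensor V z))) =
        (onHead (braid hτ) V).lTensor V (((cross hτ).lTensor _).lTensor V
          ((onHead (cross hτ) _).lTensor V ((tail V (g ⊗ₜ h)).lTensor V z))) := fun z => by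
      simp only [← LinearMap.lTensor_comp_apply]
      exact lTensor_congr (fun v => ih v) z
    rw [e1, e2, onHead_cross_lTensor, onHead_lTensor, ← LinearMap.lTensor_comp_apply,
      lTensor_congr (g := mergeHead (leftMul F V) V ∘ₗ (cross hτ).lTensor V ∘ₗ onHead τ _)
        (fun z => cross_lTensor hτ z), LinearMap.lTensor_comp_apply,
      LinearMap.lTensor_comp_apply, (leftCompatible_cross hτ).onTail, e3,
      onHead_lTensor τ, onHead_tmul, ← onHead_lTensor (cross hτ) (cross hτ), e4, ← mergeHead_lTensor,
      hb.onHead_mergeHead]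

end Naturality
end
end BraidedExterior

/-! ### The coproduct -/

namespace BraidedExterior

noncomputable section

section Coproduct

variable {F V : Type*} [Field F] [AddCommGroup V] [Module F V]
  {τ : V ⊗[F] V →ₗ[F] V ⊗[F] V}

/-- A map `f : ⋀ V → W` defined by the recursion `f (v * x) = D (v ⊗ f x)` commutes with crossings
if its value at `1` and the operator `D` do. -/
lemma cross_natural_of_recursion {W : Type*} [AddCommGroup W] [Module F W]
    (hτ : IsExteriorBraiding τ) {σ : V ⊗[F] W →ₗ[F] W ⊗[F] V} {f : ExteriorAlgebra F V →ₗ[F] W}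
    {D : V ⊗[F] W →ₗ[F] W} (hf : ∀ v x, f (ExteriorAlgebra.ι F v * x) = D (v ⊗ₜ f x))
    (h1 : ∀ v, σ (v ⊗ₜ f 1) = f 1 ⊗ₜ v)
    (hD : ∀ z : V ⊗[F] (V ⊗[F] W),
      σ (D.lTensor V z) = mergeHead D V (σ.lTensor V (onHead τ W z)))
    (y : V ⊗[F] ExteriorAlgebra F V) :
    σ (f.lTensor V y) = f.rTensor V (cross hτ y) := by
  suffices H : ∀ x v, σ (v ⊗ₜ f x) = f.rTensor V (cross hτ (v ⊗ₜ x)) by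
    have : σ ∘ₗ f.lTensor V = f.rTensor V ∘ₗ cross hτ := TensorProduct.ext' fun v x => by
      simpa using H x v
    exact LinearMap.congr_fun this y
  intro x
  induction x using left_induction with
  | one => intro v; rw [h1, cross_one, LinearMap.rTensor_tmul]
  | smul r x h => intro v; simp only [TensorProduct.tmul_smul, map_smul, h]
  | add x x' h h' => intro v; simp only [TensorProduct.tmul_add, map_add, h, h']
  | ι_mul u x h =>
    intro v
    have e := hD (v ⊗ₜ (u ⊗ₜ f x))
    rw [LinearMap.lTensor_tmul] at e
    rw [hf, e, cross_ι_mul, onHead_tmul, onHead_tmul]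
    generalize τ (v ⊗ₜ u) = t
    induction t using TensorProduct.induction_on with
    | zero => simp
    | add y y' hy hy' => simp only [map_add, hy, hy']
    | tmul u' v' =>
      simp only [LinearMap.lTensor_tmul, tail_apply, h]
      generalize cross hτ (v' ⊗ₜ x) = s
      induction s using TensorProduct.induction_on with
      | zero => simp
      | add y y' hy hy' => simp only [TensorProduct.tmul_add, map_add, hy, hy']
      | tmul a b => simp [hf]

/-- `v ⊗ z ↦ (v ⊗ 1 + 1 ⊗ v) * z`, left multiplication in the braided tensor square of `⋀ V`. -/
def primitiveMul (hτ : IsExteriorBraiding τ) :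
    V ⊗[F] (ExteriorAlgebra F V ⊗[F] ExteriorAlgebra F V) →ₗ[F]
      ExteriorAlgebra F V ⊗[F] ExteriorAlgebra F V :=
  mergeHead (leftMul F V) _ + (leftMul F V).lTensor _ ∘ₗ onHead (cross hτ) _

lemma primitiveMul_tmul (hτ : IsExteriorBraiding τ) (v : V)
    (z : ExteriorAlgebra F V ⊗[F] ExteriorAlgebra F V) :
    primitiveMul hτ (v ⊗ₜ z) =
      mergeHead (leftMul F V) _ (v ⊗ₜ z) + crossAct (cross hτ) v z := rfl

lemma crossAct_mergeHead (hτ : IsExteriorBraiding τ) (v : V)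
    (z : ExteriorAlgebra F V ⊗[F] ExteriorAlgebra F V) :
    crossAct (cross hτ) v (mergeHead (leftMul F V) _ (v ⊗ₜ z)) =
      -mergeHead (leftMul F V) _ (v ⊗ₜ crossAct (cross hτ) v z) := by
  have e : onHead τ _ (v ⊗ₜ (v ⊗ₜ z)) = -(v ⊗ₜ (v ⊗ₜ z)) := by
    rw [onHead_tmul, hτ.apply_self]; simp
  rw [crossAct_apply, ← LinearMap.lTensor_tmul, onHead_cross_lTensor, e, ← mergeHead_lTensor]
  simp only [map_neg, LinearMap.lTensor_tmul, crossAct_apply]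

lemma mergeHead_leftMul_self (v : V)
    (z : ExteriorAlgebra F V ⊗[F] ExteriorAlgebra F V) :
    mergeHead (leftMul F V) _ (v ⊗ₜ mergeHead (leftMul F V) _ (v ⊗ₜ z)) = 0 := by
  induction z using TensorProduct.induction_on with
  | zero => simp
  | add y y' hy hy' => simp only [TensorProduct.tmul_add, map_add, hy, hy', add_zero]
  | tmul a b => simp [← mul_assoc]

/-- `(v ⊗ 1 + 1 ⊗ v) ^ 2 = 0`: the squares of the two summands vanish and the mixed terms cancel
since `τ (v ⊗ v) = -v ⊗ v`. -/
lemma primitiveMul_primitiveMul (hτ : IsExteriorBraiding τ) (v : V)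
    (z : ExteriorAlgebra F V ⊗[F] ExteriorAlgebra F V) :
    primitiveMul hτ (v ⊗ₜ primitiveMul hτ (v ⊗ₜ z)) = 0 := by
  simp only [primitiveMul_tmul, TensorProduct.tmul_add, map_add, mergeHead_leftMul_self,
    crossAct_mergeHead, crossAct_crossAct hτ (leftCompatible_cross hτ)]
  abel

/-- The coproduct of `⋀ V` in which the elements of `V` are primitive, defined by the recursion
`Δ (v * x) = (v ⊗ 1 + 1 ⊗ v) * Δ x`. -/
def coproduct (hτ : IsExteriorBraiding τ) :
    ExteriorAlgebra F V →ₗ[F] ExteriorAlgebra F V ⊗[F] ExteriorAlgebra F V :=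
  CliffordAlgebra.foldr (0 : QuadraticForm F V) (TensorProduct.curry (primitiveMul hτ))
    (fun v z => by simpa using primitiveMul_primitiveMul hτ v z) (1 ⊗ₜ 1)

lemma coproduct_one (hτ : IsExteriorBraiding τ) : coproduct hτ 1 = 1 ⊗ₜ 1 :=
  CliffordAlgebra.foldr_one _ (TensorProduct.curry (primitiveMul hτ)) _ _

lemma coproduct_ι_mul (hτ : IsExteriorBraiding τ) (v : V) (x : ExteriorAlgebra F V) :
    coproduct hτ (ExteriorAlgebra.ι F v * x) = primitiveMul hτ (v ⊗ₜ coproduct hτ x) := by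
  rw [coproduct, CliffordAlgebra.foldr_mul, CliffordAlgebra.foldr_ι]
  rfl

lemma coproduct_leftMul (hτ : IsExteriorBraiding τ) (z : V ⊗[F] ExteriorAlgebra F V) :
    coproduct hτ (leftMul F V z) = primitiveMul hτ ((coproduct hτ).lTensor V z) := by
  have : coproduct hτ ∘ₗ leftMul F V = primitiveMul hτ ∘ₗ (coproduct hτ).lTensor V :=
    TensorProduct.ext' fun v x => by simp [coproduct_ι_mul]
  exact LinearMap.congr_fun this z

section Tails

variable {X : Type*} [AddCommGroup X] [Module F X]

lemma assoc_mergeHead_mergeHead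
    (y : V ⊗[F] ((ExteriorAlgebra F V ⊗[F] ExteriorAlgebra F V) ⊗[F] X)) :
    TensorProduct.assoc F (ExteriorAlgebra F V) (ExteriorAlgebra F V) X
        (mergeHead (mergeHead (leftMul F V) (ExteriorAlgebra F V)) X y) =
      mergeHead (leftMul F V) (ExteriorAlgebra F V ⊗[F] X)
        ((TensorProduct.assoc F (ExteriorAlgebra F V) (ExteriorAlgebra F V) X).toLinearMap.lTensor
          V y) := by
  suffices H : (TensorProduct.assoc F (ExteriorAlgebra F V) (ExteriorAlgebra F V) X).toLinearMap ∘ₗ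
      mergeHead (mergeHead (leftMul F V) (ExteriorAlgebra F V)) X =
      mergeHead (leftMul F V) (ExteriorAlgebra F V ⊗[F] X) ∘ₗ
        (TensorProduct.assoc F (ExteriorAlgebra F V) (ExteriorAlgebra F V) X).toLinearMap.lTensor
          V from
    LinearMap.congr_fun H y
  refine ext_tail₂ fun x y => ?_
  induction y using TensorProduct.induction_on with
  | zero => simp
  | add y y' hy hy' => simp only [map_add, hy, hy']
  | tmul v z =>
    induction z using TensorProduct.induction_on with
    | zero => simp
    | add y y' hy hy' => simp only [TensorProduct.tmul_add, map_add, hy, hy']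
    | tmul a b => simp

lemma assoc_mergeHead_crossMul (hτ : IsExteriorBraiding τ)
    (y : V ⊗[F] ((ExteriorAlgebra F V ⊗[F] ExteriorAlgebra F V) ⊗[F] X)) :
    TensorProduct.assoc F _ _ X
        (mergeHead ((leftMul F V).lTensor _ ∘ₗ onHead (cross hτ) (ExteriorAlgebra F V)) X y) =
      (mergeHead (leftMul F V) X).lTensor _ (onHead (cross hτ) _
        ((TensorProduct.assoc F _ _ X).toLinearMap.lTensor V y)) := by
  suffices H : (TensorProduct.assoc F _ _ X).toLinearMap ∘ₗ
      mergeHead ((leftMul F V).lTensor _ ∘ₗ onHead (cross hτ) (ExteriorAlgebra F V)) X =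
      (mergeHead (leftMul F V) X).lTensor _ ∘ₗ onHead (cross hτ) _ ∘ₗ
        (TensorProduct.assoc F _ _ X).toLinearMap.lTensor V from
    LinearMap.congr_fun H y
  refine ext_tail₂ fun x y => ?_
  have e : (TensorProduct.assoc F (ExteriorAlgebra F V) (ExteriorAlgebra F V) X).toLinearMap.lTensor
      V ((tail _ x).lTensor V y) = ((tail _ x).lTensor _).lTensor V y := by
    rw [← LinearMap.lTensor_comp_apply]
    refine lTensor_congr (fun y => ?_) y
    induction y using TensorProduct.induction_on with
    | zero => simp
    | tmul a b => simp
    | add y z hy hz => simp only [map_add, hy, hz]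
  simp only [LinearMap.comp_apply, e, onHead_lTensor, mergeHead_tail, LinearEquiv.coe_coe]
  generalize onHead (cross hτ) _ y = t
  induction t using TensorProduct.induction_on with
  | zero => simp
  | add y y' hy hy' => simp only [TensorProduct.add_tmul, map_add, hy, hy']
  | tmul a s => simp [mergeHead_tail]

end Tails

/-- Crossing past `(u ⊗ 1 + 1 ⊗ u) * z` crosses `u` first and `z` second. -/
lemma doubleCross_primitiveMul (hτ : IsExteriorBraiding τ)
    (z : V ⊗[F] (V ⊗[F] (ExteriorAlgebra F V ⊗[F] ExteriorAlgebra F V))) :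
    doubleCross (cross hτ) (cross hτ) ((primitiveMul hτ).lTensor V z) =
      mergeHead (primitiveMul hτ) V
        ((doubleCross (cross hτ) (cross hτ)).lTensor V (onHead τ _ z)) := by
  have hadd : ∀ y : V ⊗[F] ((ExteriorAlgebra F V ⊗[F] ExteriorAlgebra F V) ⊗[F] V),
      mergeHead (primitiveMul hτ) V y = mergeHead (mergeHead (leftMul F V) _) V y +
        mergeHead ((leftMul F V).lTensor _ ∘ₗ onHead (cross hτ) (ExteriorAlgebra F V)) V y :=
    fun y => by
      rw [mergeHead, primitiveMul, LinearMap.rTensor_add]; rfl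
  have hassoc : ∀ y, (TensorProduct.assoc F _ _ V).toLinearMap.lTensor V
      ((doubleCross (cross hτ) (cross hτ)).lTensor V y) = ((cross hτ).lTensor _).lTensor V
        ((onHead (cross hτ) (ExteriorAlgebra F V)).lTensor V y) := fun y => by
    rw [← LinearMap.lTensor_comp_apply, ← LinearMap.lTensor_comp_apply]
    exact lTensor_congr (fun y => by simp [doubleCross]) y
  apply (TensorProduct.assoc F _ _ V).injective
  rw [hadd, map_add, assoc_mergeHead_mergeHead, assoc_mergeHead_crossMul, hassoc, primitiveMul,
    LinearMap.lTensor_add, LinearMap.add_apply, map_add, map_add]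
  congr 1
  · simp only [doubleCross, LinearMap.comp_apply, LinearEquiv.coe_coe,
      LinearEquiv.apply_symm_apply]
    rw [onHead_cross_lTensor, ← mergeHead_lTensor]
  · simp only [doubleCross, LinearMap.comp_apply, LinearEquiv.coe_coe,
      LinearEquiv.apply_symm_apply]
    rw [LinearMap.lTensor_comp_apply, onHead_lTensor, ← LinearMap.lTensor_comp_apply,
      lTensor_congr (g := mergeHead (leftMul F V) V ∘ₗ (cross hτ).lTensor V ∘ₗ onHead τ _)
        (fun z => cross_lTensor hτ z), LinearMap.lTensor_comp_apply,
      LinearMap.lTensor_comp_apply, (leftCompatible_cross hτ).onTail,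
      ← onHead_lTensor (cross hτ) (cross hτ)]

lemma cross_coproduct (hτ : IsExteriorBraiding τ) (y : V ⊗[F] ExteriorAlgebra F V) :
    doubleCross (cross hτ) (cross hτ) ((coproduct hτ).lTensor V y) =
      (coproduct hτ).rTensor V (cross hτ y) :=
  cross_natural_of_recursion hτ (coproduct_ι_mul hτ)
    (fun v => by simp [coproduct_one, doubleCross, onHead_tmul, cross_one])
    (doubleCross_primitiveMul hτ) y

/-! ### The coalgebra axioms -/

lemma counit_leftMul (z : V ⊗[F] ExteriorAlgebra F V) :
    (ExteriorAlgebra.algebraMapInv (R := F) (M := V)).toLinearMap (leftMul F V z) = 0 := by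
  have : (ExteriorAlgebra.algebraMapInv (R := F) (M := V)).toLinearMap ∘ₗ leftMul F V = 0 :=
    TensorProduct.ext' fun v x => by simp [ExteriorAlgebra.algebraMapInv]
  exact LinearMap.congr_fun this z

lemma cross_counit (hτ : IsExteriorBraiding τ) (y : V ⊗[F] ExteriorAlgebra F V) :
    TensorProduct.comm F V F
      ((ExteriorAlgebra.algebraMapInv (R := F) (M := V)).toLinearMap.lTensor V y) =
      (ExteriorAlgebra.algebraMapInv (R := F) (M := V)).toLinearMap.rTensor V (cross hτ y) :=
  cross_natural_of_recursion hτ (σ := (TensorProduct.comm F V F).toLinearMap) (D := 0)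
    (fun v x => by simpa using counit_leftMul (v ⊗ₜ[F] x)) (fun v => by simp)
    (fun z => by simp [mergeHead]) y

lemma counit_rTensor_coproduct (hτ : IsExteriorBraiding τ) (x : ExteriorAlgebra F V) :
    (ExteriorAlgebra.algebraMapInv (R := F) (M := V)).toLinearMap.rTensor _ (coproduct hτ x) =
      1 ⊗ₜ x := by
  induction x using left_induction with
  | one => simp [coproduct_one]
  | smul r x h => simp only [map_smul, h, TensorProduct.tmul_smul]
  | add x y hx hy => simp only [map_add, hx, hy, TensorProduct.tmul_add]
  | ι_mul v x h =>
    have e : ∀ z, (ExteriorAlgebra.algebraMapInv (R := F) (M := V)).toLinearMap.rTensor _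
        (mergeHead (leftMul F V) (ExteriorAlgebra F V) z) = 0 := fun z => by
      rw [mergeHead, LinearMap.comp_apply, ← LinearMap.rTensor_comp_apply,
        rTensor_congr (g := 0) counit_leftMul]
      simp
    rw [coproduct_ι_mul, primitiveMul_tmul, map_add, e, zero_add, crossAct_apply,
      rTensor_lTensor_comm,
      ← onHead_rTensor (σ' := (TensorProduct.comm F V F).toLinearMap) (cross_counit hτ),
      LinearMap.lTensor_tmul, h, onHead_tmul]
    simp

lemma counit_lTensor_coproduct (hτ : IsExteriorBraiding τ) (x : ExteriorAlgebra F V) :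
    (ExteriorAlgebra.algebraMapInv (R := F) (M := V)).toLinearMap.lTensor _ (coproduct hτ x) =
      x ⊗ₜ 1 := by
  induction x using left_induction with
  | one => simp [coproduct_one]
  | smul r x h => simp only [map_smul, h, TensorProduct.smul_tmul']
  | add x y hx hy => simp only [map_add, hx, hy, TensorProduct.add_tmul]
  | ι_mul v x h =>
    rw [coproduct_ι_mul, primitiveMul_tmul, map_add, crossAct_apply,
      ← LinearMap.lTensor_comp_apply, lTensor_congr (g := 0) (fun z => counit_leftMul z),
      ← mergeHead_lTensor, LinearMap.lTensor_tmul, h]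
    simp

lemma coproduct_coassoc (hτ : IsExteriorBraiding τ) (x : ExteriorAlgebra F V) :
    TensorProduct.assoc F _ _ _ ((coproduct hτ).rTensor _ (coproduct hτ x)) =
      (coproduct hτ).lTensor _ (coproduct hτ x) := by
  induction x using left_induction with
  | one => simp [coproduct_one]
  | smul r x h => simp only [map_smul, h]
  | add x y hx hy => simp only [map_add, hx, hy]
  | ι_mul v x h =>
    -- both sides are `(v ⊗ 1 ⊗ 1 + 1 ⊗ v ⊗ 1 + 1 ⊗ 1 ⊗ v)` times the corresponding side for `x`
    have hR : (coproduct hτ).lTensor _ (primitiveMul hτ (v ⊗ₜ coproduct hτ x)) =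
        mergeHead (leftMul F V) _ (v ⊗ₜ (coproduct hτ).lTensor _ (coproduct hτ x)) +
        (primitiveMul hτ).lTensor _ (onHead (cross hτ) _
          (v ⊗ₜ (coproduct hτ).lTensor _ (coproduct hτ x))) := by
      rw [primitiveMul_tmul, map_add, ← mergeHead_lTensor, LinearMap.lTensor_tmul, crossAct_apply,
        ← LinearMap.lTensor_comp_apply,
        lTensor_congr (g := primitiveMul hτ ∘ₗ (coproduct hτ).lTensor V)
          (fun z => coproduct_leftMul hτ z), LinearMap.lTensor_comp_apply, ← onHead_lTensor,
        LinearMap.lTensor_tmul]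
    have hadd : ∀ y, mergeHead (primitiveMul hτ) (ExteriorAlgebra F V) y =
        mergeHead (mergeHead (leftMul F V) _) _ y +
        mergeHead ((leftMul F V).lTensor _ ∘ₗ onHead (cross hτ) (ExteriorAlgebra F V)) _ y :=
      fun y => by rw [mergeHead, primitiveMul, LinearMap.rTensor_add]; rfl
    have hm : ∀ z : V ⊗[F] (ExteriorAlgebra F V ⊗[F] ExteriorAlgebra F V),
        (coproduct hτ).rTensor _ (mergeHead (leftMul F V) _ z) =
        mergeHead (primitiveMul hτ) _ (((coproduct hτ).rTensor _).lTensor V z) := fun z => by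
      induction z using TensorProduct.induction_on with
      | zero => simp
      | add y y' hy hy' => simp only [map_add, hy, hy']
      | tmul w y =>
        induction y using TensorProduct.induction_on with
        | zero => simp
        | add y y' hy hy' => simp only [TensorProduct.tmul_add, map_add, hy, hy']
        | tmul a b => simp [coproduct_ι_mul]
    have hL : TensorProduct.assoc F _ _ _ ((coproduct hτ).rTensor _
          (primitiveMul hτ (v ⊗ₜ coproduct hτ x))) =
        mergeHead (leftMul F V) _ (v ⊗ₜ TensorProduct.assoc F _ _ _
          ((coproduct hτ).rTensor _ (coproduct hτ x))) +
        (primitiveMul hτ).lTensor _ (onHead (cross hτ) _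
          (v ⊗ₜ TensorProduct.assoc F _ _ _ ((coproduct hτ).rTensor _ (coproduct hτ x)))) := by
      rw [primitiveMul_tmul, map_add, hm, hadd, map_add, map_add, assoc_mergeHead_mergeHead,
        assoc_mergeHead_crossMul, LinearMap.lTensor_tmul, LinearMap.lTensor_tmul, crossAct_apply,
        rTensor_lTensor_comm, ← onHead_rTensor (cross_coproduct hτ), LinearMap.lTensor_tmul,
        ← crossAct_apply, ← (TensorProduct.assoc F _ _ _).symm_apply_apply
          ((coproduct hτ).rTensor _ (coproduct hτ x)), crossAct_doubleCross]
      simp only [LinearEquiv.apply_symm_apply, LinearEquiv.coe_coe]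
      rw [primitiveMul, LinearMap.lTensor_add, LinearMap.add_apply, LinearMap.lTensor_comp_apply,
        add_assoc]
    rw [coproduct_ι_mul, hL, hR, h]

end Coproduct
end
end BraidedExterior

/-! ### The antipode -/

namespace BraidedExterior

noncomputable section

section Antipode

variable {F V : Type*} [Field F] [AddCommGroup V] [Module F V]
  {τ : V ⊗[F] V →ₗ[F] V ⊗[F] V}

/-- The algebra endomorphism of `⋀ V` that multiplies degree `k` by `p ^ k`. -/
def scale (V : Type*) [AddCommGroup V] [Module F V] (p : F) :
    ExteriorAlgebra F V →ₐ[F] ExteriorAlgebra F V :=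
  ExteriorAlgebra.map (p • LinearMap.id)

lemma scale_ι (p : F) (v : V) :
    scale V p (ExteriorAlgebra.ι F v) = p • ExteriorAlgebra.ι F v := by
  simp [scale]

lemma scale_leftMul (p : F) (z : V ⊗[F] ExteriorAlgebra F V) :
    (scale V p).toLinearMap (leftMul F V z) =
      p • leftMul F V ((scale V p).toLinearMap.lTensor V z) := by
  have : (scale V p).toLinearMap ∘ₗ leftMul F V =
      p • (leftMul F V ∘ₗ (scale V p).toLinearMap.lTensor V) :=
    TensorProduct.ext' fun v x => by simp [scale_ι]
  exact LinearMap.congr_fun this z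

lemma cross_scale (hτ : IsExteriorBraiding τ) (p : F) (y : V ⊗[F] ExteriorAlgebra F V) :
    cross hτ ((scale V p).toLinearMap.lTensor V y) =
      (scale V p).toLinearMap.rTensor V (cross hτ y) :=
  cross_natural_of_recursion hτ (D := p • leftMul F V)
    (fun v x => by simp [scale_ι]) (fun v => by simp [cross_one])
    (fun z => by
      rw [LinearMap.lTensor_smul, LinearMap.smul_apply, map_smul, cross_lTensor, mergeHead,
        mergeHead, LinearMap.rTensor_smul]
      rfl) y

lemma antipode_operator_sq (p : F) (v : V) (x : ExteriorAlgebra F V) :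
    TensorProduct.curry (-(leftMul F V ∘ₗ (scale V p).toLinearMap.lTensor V)) v
      (TensorProduct.curry (-(leftMul F V ∘ₗ (scale V p).toLinearMap.lTensor V)) v x) =
      (0 : QuadraticForm F V) v • x := by
  simp [scale_ι, ← mul_assoc]

/-- The antipode of `⋀ V`, defined by the recursion `S (v * x) = -v * scale p (S x)`. -/
def antipodeMap (V : Type*) [AddCommGroup V] [Module F V] (p : F) :
    ExteriorAlgebra F V →ₗ[F] ExteriorAlgebra F V :=
  CliffordAlgebra.foldr (0 : QuadraticForm F V)
    (TensorProduct.curry (-(leftMul F V ∘ₗ (scale V p).toLinearMap.lTensor V)))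
    (antipode_operator_sq p) 1

lemma antipodeMap_one (p : F) : antipodeMap V p 1 = 1 :=
  CliffordAlgebra.foldr_one _ _ _ _

lemma antipodeMap_ι_mul (p : F) (v : V) (x : ExteriorAlgebra F V) :
    antipodeMap V p (ExteriorAlgebra.ι F v * x) =
      -(ExteriorAlgebra.ι F v * scale V p (antipodeMap V p x)) := by
  rw [antipodeMap, CliffordAlgebra.foldr_mul, CliffordAlgebra.foldr_ι]
  simp

lemma antipodeMap_leftMul (p : F) (z : V ⊗[F] ExteriorAlgebra F V) :
    antipodeMap V p (leftMul F V z) =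
      -leftMul F V ((scale V p).toLinearMap.lTensor V ((antipodeMap V p).lTensor V z)) := by
  have : antipodeMap V p ∘ₗ leftMul F V = -(leftMul F V ∘ₗ (scale V p).toLinearMap.lTensor V ∘ₗ
      (antipodeMap V p).lTensor V) :=
    TensorProduct.ext' fun v x => by simp [antipodeMap_ι_mul]
  exact LinearMap.congr_fun this z

lemma cross_antipode (hτ : IsExteriorBraiding τ) (p : F) (y : V ⊗[F] ExteriorAlgebra F V) :
    cross hτ ((antipodeMap V p).lTensor V y) = (antipodeMap V p).rTensor V (cross hτ y) := by
  refine cross_natural_of_recursion hτ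
    (D := -(leftMul F V ∘ₗ (scale V p).toLinearMap.lTensor V))
    (fun v x => by simp [antipodeMap_ι_mul]) (fun v => by simp [antipodeMap_one, cross_one])
    (fun z => ?_) y
  have e : ∀ y : V ⊗[F] (ExteriorAlgebra F V ⊗[F] V),
      mergeHead (-(leftMul F V ∘ₗ (scale V p).toLinearMap.lTensor V)) V y =
      -mergeHead (leftMul F V) V (((scale V p).toLinearMap.rTensor V).lTensor V y) := fun y => by
    induction y using TensorProduct.induction_on with
    | zero => simp
    | add y y' hy hy' => simp only [map_add, hy, hy', neg_add]
    | tmul v z =>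
      induction z using TensorProduct.induction_on with
      | zero => simp
      | add y y' hy hy' => simp only [TensorProduct.tmul_add, map_add, hy, hy', neg_add]
      | tmul a b => simp [TensorProduct.neg_tmul]
  have e' : ∀ y : V ⊗[F] (V ⊗[F] ExteriorAlgebra F V),
      ((scale V p).toLinearMap.rTensor V).lTensor V ((cross hτ).lTensor V y) =
      (cross hτ).lTensor V (((scale V p).toLinearMap.lTensor V).lTensor V y) := fun y => by
    rw [← LinearMap.lTensor_comp_apply, ← LinearMap.lTensor_comp_apply]
    exact lTensor_congr (fun y => (cross_scale hτ p y).symm) y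
  rw [e, e', ← onHead_lTensor, ← cross_lTensor, LinearMap.lTensor_neg, LinearMap.neg_apply, map_neg,
    LinearMap.lTensor_comp_apply]

/-! ### Naturality of the braiding in its first variable -/

lemma braid_scale_left (hτ : IsExteriorBraiding τ) (p : F) (x w : ExteriorAlgebra F V) :
    braid hτ (scale V p x ⊗ₜ w) =
      (scale V p).toLinearMap.lTensor _ (braid hτ (x ⊗ₜ w)) := by
  have hb := isExtension_braid hτ
  induction x using left_induction with
  | one => simp [hb.one]
  | smul r x h => simp only [map_smul, ← TensorProduct.smul_tmul', h]
  | add x y hx hy => simp only [map_add, TensorProduct.add_tmul, hx, hy]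
  | ι_mul v x h =>
    rw [map_mul, scale_ι, smul_mul_assoc, ← TensorProduct.smul_tmul', map_smul, hb.ι_mul, h,
      hb.ι_mul, crossAct_apply, crossAct_apply, ← LinearMap.lTensor_comp_apply,
      lTensor_congr (f := (scale V p).toLinearMap ∘ₗ leftMul F V)
        (g := p • (leftMul F V ∘ₗ (scale V p).toLinearMap.lTensor V))
        (fun z => scale_leftMul p z), LinearMap.lTensor_smul, LinearMap.smul_apply,
      LinearMap.lTensor_comp_apply, ← onHead_lTensor, LinearMap.lTensor_tmul]

lemma braid_antipode_left (hτ : IsExteriorBraiding τ) (p : F) (x w : ExteriorAlgebra F V) :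
    braid hτ (antipodeMap V p x ⊗ₜ w) = (antipodeMap V p).lTensor _ (braid hτ (x ⊗ₜ w)) := by
  have hb := isExtension_braid hτ
  induction x using left_induction with
  | one => simp [hb.one, antipodeMap_one]
  | smul r x h => simp only [map_smul, ← TensorProduct.smul_tmul', h]
  | add x y hx hy => simp only [map_add, TensorProduct.add_tmul, hx, hy]
  | ι_mul v x h =>
    rw [antipodeMap_ι_mul, TensorProduct.neg_tmul, map_neg, hb.ι_mul, braid_scale_left, h,
      hb.ι_mul, crossAct_apply, crossAct_apply, ← LinearMap.lTensor_comp_apply _ (antipodeMap V p),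
      lTensor_congr (f := antipodeMap V p ∘ₗ leftMul F V)
        (g := -(leftMul F V ∘ₗ (scale V p).toLinearMap.lTensor V ∘ₗ
        (antipodeMap V p).lTensor V)) (fun z => antipodeMap_leftMul p z), LinearMap.lTensor_neg,
      LinearMap.neg_apply, LinearMap.lTensor_comp_apply, LinearMap.lTensor_comp_apply,
      ← onHead_lTensor, ← onHead_lTensor, LinearMap.lTensor_tmul, LinearMap.lTensor_tmul]

lemma braid_counit_left (hτ : IsExteriorBraiding τ) (x w : ExteriorAlgebra F V) :
    (ExteriorAlgebra.algebraMapInv (R := F) (M := V)).toLinearMap.lTensor _ (braid hτ (x ⊗ₜ w)) =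
      w ⊗ₜ ExteriorAlgebra.algebraMapInv x := by
  have hb := isExtension_braid hτ
  induction x using left_induction with
  | one => simp [hb.one]
  | smul r x h => simp only [map_smul, ← TensorProduct.smul_tmul', h, TensorProduct.tmul_smul]
  | add x y hx hy => simp only [map_add, TensorProduct.add_tmul, hx, hy, TensorProduct.tmul_add]
  | ι_mul v x h =>
    rw [hb.ι_mul, crossAct_apply, ← LinearMap.lTensor_comp_apply,
      lTensor_congr (g := 0) (fun z => counit_leftMul z)]
    simp [ExteriorAlgebra.algebraMapInv]

lemma cross_braid_tail (hτ : IsExteriorBraiding τ) {X : Type*} [AddCommGroup X] [Module F X]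
    (z : V ⊗[F] (ExteriorAlgebra F V ⊗[F] (ExteriorAlgebra F V ⊗[F] X))) :
    (onHead (cross hτ) X).lTensor _ (onHead (cross hτ) _ ((onHead (braid hτ) X).lTensor V z)) =
      onHead (braid hτ) _ ((onHead (cross hτ) X).lTensor _ (onHead (cross hτ) _ z)) := by
  have hc : ∀ y, (cross hτ).lTensor _ (onHead (cross hτ) _ ((braid hτ).lTensor V y)) =
      onHead (braid hτ) V ((cross hτ).lTensor _ (onHead (cross hτ) _ y)) := fun y => by
    have := congrArg (TensorProduct.assoc F _ _ _) (cross_braid hτ y)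
    simpa [doubleCross, onHead] using this
  suffices H : (onHead (cross hτ) X).lTensor _ ∘ₗ onHead (cross hτ) _ ∘ₗ
      (onHead (braid hτ) X).lTensor V = onHead (braid hτ) _ ∘ₗ
        (onHead (cross hτ) X).lTensor _ ∘ₗ onHead (cross hτ) _ from LinearMap.congr_fun H z
  refine ext_tail₃ fun x y => ?_
  simp only [LinearMap.comp_apply]
  rw [lTensor_onHead_tail, onHead_lTensor, lTensor_onHead_tail, hc, onHead_lTensor,
    lTensor_onHead_tail, onHead_lTensor]

lemma braid_coproduct_left (hτ : IsExteriorBraiding τ) (x w : ExteriorAlgebra F V) :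
    (coproduct hτ).lTensor _ (braid hτ (x ⊗ₜ w)) = onHead (braid hτ) _
      ((braid hτ).lTensor _ (TensorProduct.assoc F _ _ _ (coproduct hτ x ⊗ₜ w))) := by
  have hb := isExtension_braid hτ
  induction x using left_induction with
  | one => simp [hb.one, coproduct_one, onHead_tmul]
  | smul r x h => simp only [map_smul, ← TensorProduct.smul_tmul', h]
  | add x y hx hy => simp only [map_add, TensorProduct.add_tmul, hx, hy]
  | ι_mul v x h =>
    rw [hb.ι_mul, crossAct_apply, ← LinearMap.lTensor_comp_apply,
      lTensor_congr (g := primitiveMul hτ ∘ₗ (coproduct hτ).lTensor V)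
        (fun z => coproduct_leftMul hτ z), LinearMap.lTensor_comp_apply, ← onHead_lTensor,
      LinearMap.lTensor_tmul, h, coproduct_ι_mul]
    generalize coproduct hτ x = t
    induction t using TensorProduct.induction_on with
    | zero => simp
    | add y y' hy hy' =>
      simp only [TensorProduct.add_tmul, TensorProduct.tmul_add, map_add, hy, hy']
    | tmul a b =>
      rw [primitiveMul_tmul, primitiveMul, LinearMap.lTensor_add, LinearMap.add_apply,
        TensorProduct.add_tmul, map_add, map_add, map_add]
      congr 1
      · have e : ∀ z, onHead (braid hτ) _ ((ExteriorAlgebra.ι F v * a) ⊗ₜ z) =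
          onHead (braid hτ) (ExteriorAlgebra F V)
            (mergeHead (leftMul F V) _ (v ⊗ₜ (a ⊗ₜ z))) := fun z => by simp
        simp only [mergeHead_tmul, leftMul_tmul, TensorProduct.assoc_tmul, LinearMap.lTensor_tmul]
        rw [e, hb.onHead_mergeHead, LinearMap.lTensor_tmul]
      · rw [LinearMap.lTensor_comp_apply, ← LinearMap.lTensor_tmul, cross_braid_tail,
          TensorProduct.assoc_tmul, LinearMap.lTensor_tmul, onHead_tmul, crossAct_apply,
          onHead_tmul]
        generalize cross hτ (v ⊗ₜ a) = s
        rw [← onHead_lTensor]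
        congr 1
        induction s using TensorProduct.induction_on with
        | zero => simp
        | add y y' hy hy' => simp only [TensorProduct.add_tmul, map_add, hy, hy']
        | tmul c u =>
          simp only [LinearMap.lTensor_tmul, tail_apply, leftMul_tmul, TensorProduct.assoc_tmul,
            hb.ι_mul, crossAct_apply]

/-! ### Compatibility of product and coproduct -/

lemma mul_onMiddle_tmul (β : ExteriorAlgebra F V ⊗[F] ExteriorAlgebra F V →ₗ[F]
      ExteriorAlgebra F V ⊗[F] ExteriorAlgebra F V) (x y z w : ExteriorAlgebra F V) :
    TensorProduct.map (LinearMap.mul' F _) (LinearMap.mul' F _)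
        (onMiddle β ((x ⊗ₜ y) ⊗ₜ (z ⊗ₜ w))) =
      TensorProduct.map (LinearMap.mulLeft F x) (LinearMap.mulRight F w) (β (y ⊗ₜ z)) := by
  simp only [onMiddle, LinearMap.comp_apply, LinearEquiv.coe_coe, TensorProduct.assoc_tmul,
    LinearMap.lTensor_tmul, TensorProduct.assoc_symm_tmul, LinearMap.rTensor_tmul]
  generalize β (y ⊗ₜ z) = t
  induction t using TensorProduct.induction_on with
  | zero => simp
  | add y y' hy hy' => simp only [TensorProduct.add_tmul, TensorProduct.tmul_add, map_add, hy, hy']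
  | tmul a b => simp

/-- Left multiplication by `v ⊗ 1 + 1 ⊗ v` is associative with the product of the braided tensor
square. -/
lemma primitiveMul_mul (hτ : IsExteriorBraiding τ) (v : V)
    (X Y : ExteriorAlgebra F V ⊗[F] ExteriorAlgebra F V) :
    primitiveMul hτ (v ⊗ₜ TensorProduct.map (LinearMap.mul' F _) (LinearMap.mul' F _)
        (onMiddle (braid hτ) (X ⊗ₜ Y))) =
      TensorProduct.map (LinearMap.mul' F _) (LinearMap.mul' F _)
        (onMiddle (braid hτ) (primitiveMul hτ (v ⊗ₜ X) ⊗ₜ Y)) := by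
  have hb := isExtension_braid hτ
  induction X using TensorProduct.induction_on with
  | zero => simp
  | add y y' hy hy' => simp only [TensorProduct.add_tmul, TensorProduct.tmul_add, map_add, hy, hy']
  | tmul x y =>
  induction Y using TensorProduct.induction_on with
  | zero => simp
  | add y y' hy hy' => simp only [TensorProduct.tmul_add, map_add, hy, hy']
  | tmul z w =>
    rw [mul_onMiddle_tmul, primitiveMul_tmul, primitiveMul_tmul, TensorProduct.add_tmul, map_add,
      map_add, mergeHead_tmul, leftMul_tmul, mul_onMiddle_tmul]
    congr 1
    · generalize braid hτ (y ⊗ₜ z) = t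
      induction t using TensorProduct.induction_on with
      | zero => simp
      | add y y' hy hy' => simp only [TensorProduct.tmul_add, map_add, hy, hy']
      | tmul a b => simp
    · -- pulling `v` past the product `x * a` is pulling it past `x` and then past `a`
      have hmul : ∀ a, cross hτ (v ⊗ₜ (x * a)) = mergeHead (LinearMap.mul' F _) V
          ((cross hτ).lTensor _ ((tail _ a).lTensor _ (cross hτ (v ⊗ₜ x)))) := fun a => by
        have := cross_mul hτ (v ⊗ₜ (x ⊗ₜ a))
        simpa [doubleCross, mergeHead, onHead_tmul] using this
      have e1 : crossAct (cross hτ) v (x ⊗ₜ y) = (LinearMap.lTensor _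
          (leftMul F V ∘ₗ tail V y)) (cross hτ (v ⊗ₜ x)) := by
        rw [crossAct_apply, onHead_tmul, ← LinearMap.lTensor_comp_apply]
      have e2 : ∀ t, crossAct (cross hτ) v (TensorProduct.map (LinearMap.mulLeft F x)
            (LinearMap.mulRight F w) t) =
          TensorProduct.map (LinearMap.mul' F _) (LinearMap.mulRight F w)
            ((TensorProduct.assoc F _ _ _).symm (((leftMul F V).lTensor _).lTensor _
              ((onHead (cross hτ) _).lTensor _
                ((tail _ t).lTensor _ (cross hτ (v ⊗ₜ x)))))) := fun t => by
        induction t using TensorProduct.induction_on with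
        | zero =>
          have : tail V (0 : ExteriorAlgebra F V ⊗[F] ExteriorAlgebra F V) = (0 : V →ₗ[F] _) := by
            ext; simp
          simp [this]
        | add y y' hy hy' =>
          have : tail V (y + y') = (tail V y + tail V y' : V →ₗ[F] _) := by
            ext; simp [TensorProduct.tmul_add]
          simp only [map_add, hy, hy', this, LinearMap.lTensor_add, LinearMap.add_apply]
        | tmul a b =>
          rw [TensorProduct.map_tmul, LinearMap.mulLeft_apply, LinearMap.mulRight_apply,
            crossAct_apply, onHead_tmul, hmul]
          generalize cross hτ (v ⊗ₜ x) = s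
          induction s using TensorProduct.induction_on with
          | zero => simp
          | add y y' hy hy' => simp only [map_add, hy, hy']
          | tmul c u =>
            simp only [LinearMap.lTensor_tmul, tail_apply, onHead_tmul]
            generalize cross hτ (u ⊗ₜ a) = r
            induction r using TensorProduct.induction_on with
            | zero => simp
            | add y y' hy hy' => simp only [TensorProduct.tmul_add, map_add, hy, hy']
            | tmul d u' => simp [mul_assoc]
      rw [e2, e1]
      generalize cross hτ (v ⊗ₜ x) = s
      induction s using TensorProduct.induction_on with
      | zero => simp
      | add y y' hy hy' => simp only [TensorProduct.add_tmul, map_add, hy, hy']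
      | tmul c u =>
        simp only [LinearMap.lTensor_tmul, tail_apply, LinearMap.comp_apply, leftMul_tmul]
        rw [mul_onMiddle_tmul, hb.ι_mul, crossAct_apply]
        generalize (leftMul F V).lTensor _ (onHead (cross hτ) _ (u ⊗ₜ braid hτ (y ⊗ₜ z))) = r
        induction r using TensorProduct.induction_on with
        | zero => simp
        | add y y' hy hy' => simp only [TensorProduct.tmul_add, map_add, hy, hy']
        | tmul d u' => simp

lemma coproduct_mul (hτ : IsExteriorBraiding τ) (x y : ExteriorAlgebra F V) :
    coproduct hτ (x * y) = TensorProduct.map (LinearMap.mul' F _) (LinearMap.mul' F _)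
      (onMiddle (braid hτ) (coproduct hτ x ⊗ₜ coproduct hτ y)) := by
  have hb := isExtension_braid hτ
  induction x using left_induction with
  | one =>
    rw [one_mul, coproduct_one]
    generalize coproduct hτ y = t
    induction t using TensorProduct.induction_on with
    | zero => simp
    | add y y' hy hy' => simp only [TensorProduct.tmul_add, map_add, ← hy, ← hy']
    | tmul a b => rw [mul_onMiddle_tmul, hb.one]; simp
  | smul r x h => simp only [smul_mul_assoc, map_smul, ← TensorProduct.smul_tmul', h]
  | add x x' h h' => simp only [add_mul, map_add, TensorProduct.add_tmul, h, h']
  | ι_mul v x h => rw [mul_assoc, coproduct_ι_mul, h, primitiveMul_mul, coproduct_ι_mul]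

/-! ### The antipode axioms -/

/-- If the product of two vectors after `τ` is `p` times their product, then the product of
`⋀ V` after crossing `v` past `x` is `v * scale p x`. -/
lemma mul_cross (hτ : IsExteriorBraiding τ) {p : F}
    (hp : ∀ y : V ⊗[F] V, LinearMap.mul' F _ (TensorProduct.map (ExteriorAlgebra.ι F)
      (ExteriorAlgebra.ι F) (τ y)) = p • LinearMap.mul' F _
        (TensorProduct.map (ExteriorAlgebra.ι F) (ExteriorAlgebra.ι F) y))
    (v : V) (x : ExteriorAlgebra F V) :
    LinearMap.mul' F _ ((ExteriorAlgebra.ι F).lTensor _ (cross hτ (v ⊗ₜ x))) =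
      ExteriorAlgebra.ι F v * scale V p x := by
  induction x using left_induction generalizing v with
  | one => simp [cross_one]
  | smul r x h => simp only [TensorProduct.tmul_smul, map_smul, h, mul_smul_comm]
  | add x x' h h' => simp only [TensorProduct.tmul_add, map_add, h, h', mul_add]
  | ι_mul u x h =>
    have e : ∀ t : V ⊗[F] V, LinearMap.mul' F _ ((ExteriorAlgebra.ι F).lTensor _
        (mergeHead (leftMul F V) V ((cross hτ).lTensor V ((tail _ x).lTensor V t)))) =
        LinearMap.mul' F _ (TensorProduct.map (ExteriorAlgebra.ι F) (ExteriorAlgebra.ι F) t) *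
          scale V p x := fun t => by
      induction t using TensorProduct.induction_on with
      | zero => simp
      | add y y' hy hy' => simp only [map_add, hy, hy', add_mul]
      | tmul c w =>
        simp only [LinearMap.lTensor_tmul, tail_apply, TensorProduct.map_tmul,
          LinearMap.mul'_apply, mul_assoc, ← h]
        generalize cross hτ (w ⊗ₜ x) = s
        induction s using TensorProduct.induction_on with
        | zero => simp
        | add y y' hy hy' => simp only [TensorProduct.tmul_add, map_add, hy, hy', mul_add]
        | tmul a b => simp [mul_assoc]
    rw [cross_ι_mul, onHead_tmul, e, hp, map_mul, scale_ι]
    simp [mul_assoc]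

lemma antipode_mul_left (hτ : IsExteriorBraiding τ) {p : F}
    (hp : ∀ y : V ⊗[F] V, LinearMap.mul' F _ (TensorProduct.map (ExteriorAlgebra.ι F)
      (ExteriorAlgebra.ι F) (τ y)) = p • LinearMap.mul' F _
        (TensorProduct.map (ExteriorAlgebra.ι F) (ExteriorAlgebra.ι F) y))
    (x : ExteriorAlgebra F V) :
    LinearMap.mul' F _ ((antipodeMap V p).rTensor _ (coproduct hτ x)) =
      algebraMap F _ (ExteriorAlgebra.algebraMapInv x) := by
  induction x using left_induction with
  | one => simp [coproduct_one, antipodeMap_one]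
  | smul r x h =>
    rw [map_smul, map_smul, map_smul, h, map_smul, smul_eq_mul, map_mul, Algebra.smul_def]
  | add x x' h h' => simp only [map_add, h, h']
  | ι_mul v x h =>
    -- the two summands of the coproduct of `v * x` cancel
    have e : ∀ t, LinearMap.mul' F _ ((antipodeMap V p).rTensor _
        (primitiveMul hτ (v ⊗ₜ t))) = 0 := fun t => by
      induction t using TensorProduct.induction_on with
      | zero => simp
      | add y y' hy hy' => simp only [TensorProduct.tmul_add, map_add, hy, hy', add_zero]
      | tmul a b =>
        have e1 : ∀ s, LinearMap.mul' F _ ((leftMul F V).lTensor _ ((tail V b).lTensor _ s)) =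
            LinearMap.mul' F _ ((ExteriorAlgebra.ι F).lTensor _ s) * b := fun s => by
          induction s using TensorProduct.induction_on with
          | zero => simp
          | add y y' hy hy' => simp only [map_add, hy, hy', add_mul]
          | tmul a b => simp [mul_assoc]
        rw [primitiveMul_tmul, map_add, mergeHead_tmul, leftMul_tmul, LinearMap.rTensor_tmul,
          antipodeMap_ι_mul, crossAct_apply, rTensor_lTensor_comm,
          ← onHead_rTensor (cross_antipode hτ p), LinearMap.lTensor_tmul, LinearMap.rTensor_tmul,
          onHead_tmul, map_add, e1, mul_cross hτ hp]
        simp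
    rw [coproduct_ι_mul, e]
    simp [ExteriorAlgebra.algebraMapInv]

lemma antipode_mul_right (hτ : IsExteriorBraiding τ) {p : F}
    (hp : ∀ y : V ⊗[F] V, LinearMap.mul' F _ (TensorProduct.map (ExteriorAlgebra.ι F)
      (ExteriorAlgebra.ι F) (τ y)) = p • LinearMap.mul' F _
        (TensorProduct.map (ExteriorAlgebra.ι F) (ExteriorAlgebra.ι F) y))
    (x : ExteriorAlgebra F V) :
    LinearMap.mul' F _ ((antipodeMap V p).lTensor _ (coproduct hτ x)) =
      algebraMap F _ (ExteriorAlgebra.algebraMapInv x) := by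
  induction x using left_induction with
  | one => simp [coproduct_one, antipodeMap_one]
  | smul r x h =>
    rw [map_smul, map_smul, map_smul, h, map_smul, smul_eq_mul, map_mul, Algebra.smul_def]
  | add x x' h h' => simp only [map_add, h, h']
  | ι_mul v x h =>
    have e : ∀ t, LinearMap.mul' F _ ((antipodeMap V p).lTensor _
        (primitiveMul hτ (v ⊗ₜ t))) = ExteriorAlgebra.ι F v *
          (LinearMap.mul' F _ ((antipodeMap V p).lTensor _ t) -
            scale V p (LinearMap.mul' F _ ((antipodeMap V p).lTensor _ t))) := fun t => by
      induction t using TensorProduct.induction_on with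
      | zero => simp
      | add y y' hy hy' =>
        simp only [TensorProduct.tmul_add, map_add, hy, hy', mul_sub, mul_add]
        abel
      | tmul a b =>
        have e1 : ∀ s, LinearMap.mul' F _ ((antipodeMap V p).lTensor _
            ((leftMul F V).lTensor _ ((tail V b).lTensor _ s))) =
            -(LinearMap.mul' F _ ((ExteriorAlgebra.ι F).lTensor _ s) *
              scale V p (antipodeMap V p b)) := fun s => by
          induction s using TensorProduct.induction_on with
          | zero => simp
          | add y y' hy hy' => simp only [map_add, hy, hy', add_mul, neg_add]
          | tmul a b => simp [mul_assoc, antipodeMap_ι_mul]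
        rw [primitiveMul_tmul, map_add, mergeHead_tmul, leftMul_tmul, LinearMap.lTensor_tmul,
          LinearMap.lTensor_tmul, crossAct_apply, onHead_tmul, map_add, e1, mul_cross hτ hp]
        simp [mul_assoc, mul_add, sub_eq_add_neg]
    rw [coproduct_ι_mul, e, h]
    simp [ExteriorAlgebra.algebraMapInv]

end Antipode
end
end BraidedExterior

/-! ### The Hecke type braiding -/

namespace BraidedExterior

noncomputable section

section Hecke

variable {F V : Type*} [Field F] [AddCommGroup V] [Module F V]

lemma ext_tmul_basis {I M : Type*} [AddCommGroup M] [Module F M] (𝔹 : Module.Basis I F V)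
    {f g : V ⊗[F] V →ₗ[F] M} (h : ∀ a b, f (𝔹 a ⊗ₜ 𝔹 b) = g (𝔹 a ⊗ₜ 𝔹 b)) : f = g :=
  (𝔹.tensorProduct 𝔹).ext fun ab => by
    rw [Module.Basis.tensorProduct_apply]; exact h ab.1 ab.2

variable {I : Type*} [LinearOrder I]

lemma tau_basis (𝔹 : Module.Basis I F V) (p : F) (a b : I) :
    tau 𝔹 p (𝔹 a ⊗ₜ 𝔹 b) = (p ^ theta a b - 1) • (𝔹 a ⊗ₜ[F] 𝔹 b) -
      p ^ theta b a • (𝔹 b ⊗ₜ[F] 𝔹 a) := by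
  have := (𝔹.tensorProduct 𝔹).constr_basis F (fun ab : I × I =>
    (p ^ theta ab.1 ab.2 - 1) • (𝔹 ab.1 ⊗ₜ[F] 𝔹 ab.2) -
      p ^ theta ab.2 ab.1 • (𝔹 ab.2 ⊗ₜ[F] 𝔹 ab.1)) (a, b)
  rwa [Module.Basis.tensorProduct_apply] at this

lemma tau_self (𝔹 : Module.Basis I F V) (p : F) (a : I) :
    tau 𝔹 p (𝔹 a ⊗ₜ 𝔹 a) = -(𝔹 a ⊗ₜ[F] 𝔹 a) := by
  simp [tau_basis, theta]

lemma tau_lt (𝔹 : Module.Basis I F V) (p : F) {a b : I} (h : a < b) :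
    tau 𝔹 p (𝔹 a ⊗ₜ 𝔹 b) = -(p • (𝔹 b ⊗ₜ[F] 𝔹 a)) := by
  simp [tau_basis, theta, h, not_lt_of_gt h]

lemma tau_gt (𝔹 : Module.Basis I F V) (p : F) {a b : I} (h : b < a) :
    tau 𝔹 p (𝔹 a ⊗ₜ 𝔹 b) = (p - 1) • (𝔹 a ⊗ₜ[F] 𝔹 b) - 𝔹 b ⊗ₜ[F] 𝔹 a := by
  simp [tau_basis, theta, h, not_lt_of_gt h]

/-- The Hecke relation `(τ - p)(τ + 1) = 0`. -/
lemma tau_tau (𝔹 : Module.Basis I F V) (p : F) :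
    tau 𝔹 p ∘ₗ tau 𝔹 p = (p - 1) • tau 𝔹 p + p • LinearMap.id := by
  refine ext_tmul_basis 𝔹 fun a b => ?_
  rcases lt_trichotomy a b with h | rfl | h
  · simp only [LinearMap.comp_apply, LinearMap.add_apply, LinearMap.smul_apply,
      LinearMap.id_apply, tau_lt 𝔹 p h, map_neg, map_smul, tau_gt 𝔹 p h]
    module
  · simp only [LinearMap.comp_apply, LinearMap.add_apply, LinearMap.smul_apply,
      LinearMap.id_apply, tau_self, map_neg]
    module
  · simp only [LinearMap.comp_apply, LinearMap.add_apply, LinearMap.smul_apply,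
      LinearMap.id_apply, tau_gt 𝔹 p h, map_sub, map_smul, tau_lt 𝔹 p h]
    module

lemma exists_tau_inverse (𝔹 : Module.Basis I F V) {p : F} (hp : p ≠ 0) :
    ∃ τ' : V ⊗[F] V →ₗ[F] V ⊗[F] V,
      tau 𝔹 p ∘ₗ τ' = LinearMap.id ∧ τ' ∘ₗ tau 𝔹 p = LinearMap.id := by
  refine ⟨p⁻¹ • (tau 𝔹 p - (p - 1) • LinearMap.id), ?_, ?_⟩
  · rw [LinearMap.comp_smul, LinearMap.comp_sub, tau_tau, LinearMap.comp_smul, LinearMap.comp_id,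
      add_sub_cancel_left, smul_smul, inv_mul_cancel₀ hp, one_smul]
  · rw [LinearMap.smul_comp, LinearMap.sub_comp, tau_tau, LinearMap.smul_comp, LinearMap.id_comp,
      add_sub_cancel_left, smul_smul, inv_mul_cancel₀ hp, one_smul]

lemma tau_yang_baxter (𝔹 : Module.Basis I F V) (p : F) (x : V ⊗[F] (V ⊗[F] V)) :
    onHead (tau 𝔹 p) V ((tau 𝔹 p).lTensor V (onHead (tau 𝔹 p) V x)) =
      (tau 𝔹 p).lTensor V (onHead (tau 𝔹 p) V ((tau 𝔹 p).lTensor V x)) := by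
  suffices H : onHead (tau 𝔹 p) V ∘ₗ (tau 𝔹 p).lTensor V ∘ₗ onHead (tau 𝔹 p) V =
      (tau 𝔹 p).lTensor V ∘ₗ onHead (tau 𝔹 p) V ∘ₗ (tau 𝔹 p).lTensor V from
    LinearMap.congr_fun H x
  refine (𝔹.tensorProduct (𝔹.tensorProduct 𝔹)).ext fun ⟨a, b, c⟩ => ?_
  rw [Module.Basis.tensorProduct_apply, Module.Basis.tensorProduct_apply]
  simp only [LinearMap.comp_apply]
  have H : (a < b ∨ a = b ∨ b < a) ∧ (b < c ∨ b = c ∨ c < b) ∧ (a < c ∨ a = c ∨ c < a) :=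
    ⟨lt_trichotomy a b, lt_trichotomy b c, lt_trichotomy a c⟩
  rcases H with ⟨h | h | h, h' | h' | h', h'' | h'' | h''⟩ <;> (try subst h) <;>
    (try subst h') <;> (try subst h'') <;>
    first
    | (exfalso; order)
    | (simp only [LinearMap.lTensor_tmul, onHead_tmul, map_neg, map_sub, map_smul, neg_neg,
        TensorProduct.tmul_neg, TensorProduct.tmul_sub, TensorProduct.tmul_smul, tail_apply,
        tau_self, tau_lt, tau_gt, *]
       try module)

lemma tau_symm_tmul (𝔹 : Module.Basis I F V) (p : F) (u v : V) :
    tau 𝔹 p (u ⊗ₜ v + v ⊗ₜ u) = -(u ⊗ₜ v + v ⊗ₜ u) := by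
  suffices H : tau 𝔹 p ∘ₗ (LinearMap.id + (TensorProduct.comm F V V).toLinearMap) =
      -(LinearMap.id + (TensorProduct.comm F V V).toLinearMap) by
    simpa using LinearMap.congr_fun H (u ⊗ₜ v)
  refine ext_tmul_basis 𝔹 fun a b => ?_
  rcases lt_trichotomy a b with h | rfl | h
  · simp only [LinearMap.comp_apply, LinearMap.add_apply, LinearMap.neg_apply, LinearMap.id_apply,
      LinearEquiv.coe_coe, TensorProduct.comm_tmul, map_add, tau_lt 𝔹 p h, tau_gt 𝔹 p h]
    module
  · simp only [LinearMap.comp_apply, LinearMap.add_apply, LinearMap.neg_apply, LinearMap.id_apply,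
      LinearEquiv.coe_coe, TensorProduct.comm_tmul, map_add, tau_self]
    module
  · simp only [LinearMap.comp_apply, LinearMap.add_apply, LinearMap.neg_apply, LinearMap.id_apply,
      LinearEquiv.coe_coe, TensorProduct.comm_tmul, map_add, tau_lt 𝔹 p h, tau_gt 𝔹 p h]
    module

lemma tau_tmul_self (𝔹 : Module.Basis I F V) (p : F) (v : V) :
    tau 𝔹 p (v ⊗ₜ v) = -(v ⊗ₜ v) := by
  induction 𝔹.mem_span v using Submodule.span_induction with
  | mem x hx => obtain ⟨a, rfl⟩ := hx; exact tau_self 𝔹 p a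
  | zero => simp
  | add x y _ _ hx hy =>
    have e : (x + y) ⊗ₜ[F] (x + y) = x ⊗ₜ x + y ⊗ₜ y + (x ⊗ₜ y + y ⊗ₜ x) := by
      simp only [TensorProduct.add_tmul, TensorProduct.tmul_add]; abel
    rw [e, map_add, map_add, hx, hy, tau_symm_tmul]
    abel
  | smul r x _ hx =>
    simp only [TensorProduct.tmul_smul, ← TensorProduct.smul_tmul', map_smul, hx, smul_neg]

lemma ι_mul_ι_comm (u v : V) : ExteriorAlgebra.ι F u * ExteriorAlgebra.ι F v =
    -(ExteriorAlgebra.ι F v * ExteriorAlgebra.ι F u) :=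
  eq_neg_of_add_eq_zero_left (ExteriorAlgebra.ι_add_mul_swap u v)

lemma isExteriorBraiding_tau (𝔹 : Module.Basis I F V) (p : F) :
    IsExteriorBraiding (tau 𝔹 p) where
  yang_baxter := tau_yang_baxter 𝔹 p
  apply_self := tau_tmul_self 𝔹 p
  factor := by
    -- `a ⊗ b` with `a < b` goes to `a * b`, all other `a ⊗ b` go to `0`
    let ρ : V ⊗[F] V →ₗ[F] ExteriorAlgebra F V := (𝔹.tensorProduct 𝔹).constr F fun ab : I × I =>
      if ab.1 < ab.2 then ExteriorAlgebra.ι F (𝔹 ab.1) * ExteriorAlgebra.ι F (𝔹 ab.2) else 0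
    have hρ : ∀ a b, ρ (𝔹 a ⊗ₜ 𝔹 b) =
        if a < b then ExteriorAlgebra.ι F (𝔹 a) * ExteriorAlgebra.ι F (𝔹 b) else 0 := fun a b => by
      rw [← Module.Basis.tensorProduct_apply]
      exact (𝔹.tensorProduct 𝔹).constr_basis F _ (a, b)
    refine ⟨ρ, fun u v => ?_⟩
    suffices H : LinearMap.mul' F _ ∘ₗ
        TensorProduct.map (ExteriorAlgebra.ι F) (ExteriorAlgebra.ι F) =
        ρ ∘ₗ (LinearMap.id + tau 𝔹 p) by
      simpa using LinearMap.congr_fun H (u ⊗ₜ v)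
    refine ext_tmul_basis 𝔹 fun a b => ?_
    simp only [LinearMap.comp_apply, TensorProduct.map_tmul, LinearMap.mul'_apply,
      LinearMap.add_apply, LinearMap.id_apply]
    rcases lt_trichotomy a b with h | rfl | h
    · rw [tau_lt 𝔹 p h]
      simp [hρ, h, not_lt_of_gt h]
    · simp [tau_self]
    · rw [tau_gt 𝔹 p h]
      simp [hρ, h, not_lt_of_gt h, ι_mul_ι_comm (𝔹 a)]

/-- The Hecke parameter appears as `∇ τ = p ∇` on `V ⊗ V`. -/
lemma mul_tau (𝔹 : Module.Basis I F V) (p : F) (y : V ⊗[F] V) :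
    LinearMap.mul' F _ (TensorProduct.map (ExteriorAlgebra.ι F) (ExteriorAlgebra.ι F)
      (tau 𝔹 p y)) = p • LinearMap.mul' F _
        (TensorProduct.map (ExteriorAlgebra.ι F) (ExteriorAlgebra.ι F) y) := by
  suffices H : LinearMap.mul' F _ ∘ₗ
      TensorProduct.map (ExteriorAlgebra.ι F) (ExteriorAlgebra.ι F) ∘ₗ tau 𝔹 p =
      p • (LinearMap.mul' F _ ∘ₗ
        TensorProduct.map (ExteriorAlgebra.ι F) (ExteriorAlgebra.ι F)) from
    LinearMap.congr_fun H y
  refine ext_tmul_basis 𝔹 fun a b => ?_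
  simp only [LinearMap.comp_apply, TensorProduct.map_tmul, LinearMap.mul'_apply,
    LinearMap.smul_apply]
  rcases lt_trichotomy a b with h | rfl | h
  · rw [tau_lt 𝔹 p h]
    simp [ι_mul_ι_comm (𝔹 a)]
  · simp [tau_self]
  · rw [tau_gt 𝔹 p h]
    simp only [map_sub, map_smul, TensorProduct.map_tmul, LinearMap.mul'_apply,
      ι_mul_ι_comm (𝔹 a)]
    module

end Hecke
end
end BraidedExterior

/-! ### Existence of the braided Hopf structure -/

namespace BraidedExterior

noncomputable section

section Structure

variable {F V : Type*} [Field F] [AddCommGroup V] [Module F V]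
  {τ : V ⊗[F] V →ₗ[F] V ⊗[F] V}

lemma braid_mul_left (hτ : IsExteriorBraiding τ) (x y w : ExteriorAlgebra F V) :
    braid hτ ((x * y) ⊗ₜ w) = (LinearMap.mul' F _).lTensor _
      (onHead (braid hτ) _ (x ⊗ₜ braid hτ (y ⊗ₜ w))) := by
  have hb := isExtension_braid hτ
  induction x using left_induction with
  | one =>
    rw [one_mul]
    generalize braid hτ (y ⊗ₜ w) = t
    induction t using TensorProduct.induction_on with
    | zero => simp
    | add y y' hy hy' => simp only [TensorProduct.tmul_add, map_add, ← hy, ← hy']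
    | tmul a b => simp [onHead_tmul, hb.one]
  | smul r x h => simp only [smul_mul_assoc, ← TensorProduct.smul_tmul', map_smul, h]
  | add x x' h h' => simp only [add_mul, TensorProduct.add_tmul, map_add, h, h']
  | ι_mul v x h =>
    have e : (ExteriorAlgebra.ι F v * x) ⊗ₜ[F] braid hτ (y ⊗ₜ w) =
        mergeHead (leftMul F V) _ (v ⊗ₜ (x ⊗ₜ braid hτ (y ⊗ₜ w))) := by simp
    have e' : ∀ z, LinearMap.mul' F _ (mergeHead (leftMul F V) _ z) =
        leftMul F V ((LinearMap.mul' F _).lTensor V z) := fun z => by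
      suffices H : LinearMap.mul' F _ ∘ₗ mergeHead (leftMul F V) _ =
          leftMul F V ∘ₗ (LinearMap.mul' F _).lTensor V from LinearMap.congr_fun H z
      refine ext_tail₂ fun a y => ?_
      induction y using TensorProduct.induction_on with
      | zero => simp
      | add y y' hy hy' => simp only [map_add, hy, hy']
      | tmul u b => simp [mul_assoc]
    rw [mul_assoc, hb.ι_mul, h, e, hb.onHead_mergeHead, crossAct_apply,
      ← LinearMap.lTensor_comp_apply _ (LinearMap.mul' F _),
      lTensor_congr (f := LinearMap.mul' F _ ∘ₗ mergeHead (leftMul F V) _)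
        (g := leftMul F V ∘ₗ (LinearMap.mul' F _).lTensor V) e',
      LinearMap.lTensor_comp_apply, ← onHead_lTensor, LinearMap.lTensor_tmul,
      LinearMap.lTensor_tmul]

lemma braid_ι_left (hτ : IsExteriorBraiding τ) (v : V) (x : ExteriorAlgebra F V) :
    braid hτ (ExteriorAlgebra.ι F v ⊗ₜ x) =
      (ExteriorAlgebra.ι F).lTensor _ (cross hτ (v ⊗ₜ x)) := by
  have hb := isExtension_braid hτ
  have := hb.ι_mul v 1 x
  rw [mul_one, hb.one, crossAct_apply, onHead_tmul, ← LinearMap.lTensor_comp_apply] at this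
  rw [this]
  exact lTensor_congr (fun u => by simp) _

lemma cross_ι (hτ : IsExteriorBraiding τ) (v u : V) :
    cross hτ (v ⊗ₜ ExteriorAlgebra.ι F u) = (ExteriorAlgebra.ι F).rTensor V (τ (v ⊗ₜ u)) := by
  have := cross_ι_mul hτ v u 1
  rw [mul_one, onHead_tmul] at this
  rw [this]
  generalize τ (v ⊗ₜ u) = t
  induction t using TensorProduct.induction_on with
  | zero => simp
  | add y y' hy hy' => simp only [map_add, hy, hy']
  | tmul a b => simp [cross_one]

lemma braid_map_ι (hτ : IsExteriorBraiding τ) (w : V ⊗[F] V) :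
    braid hτ (TensorProduct.map (ExteriorAlgebra.ι F) (ExteriorAlgebra.ι F) w) =
      TensorProduct.map (ExteriorAlgebra.ι F) (ExteriorAlgebra.ι F) (τ w) := by
  induction w using TensorProduct.induction_on with
  | zero => simp
  | add y y' hy hy' => simp only [map_add, hy, hy']
  | tmul v u =>
    rw [TensorProduct.map_tmul, braid_ι_left, cross_ι, ← LinearMap.comp_apply,
      LinearMap.lTensor_comp_rTensor]

lemma coproduct_ι (hτ : IsExteriorBraiding τ) (v : V) :
    coproduct hτ (ExteriorAlgebra.ι F v) =
      ExteriorAlgebra.ι F v ⊗ₜ 1 + 1 ⊗ₜ ExteriorAlgebra.ι F v := by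
  have := coproduct_ι_mul hτ v 1
  rw [mul_one, coproduct_one, primitiveMul_tmul, crossAct_apply, onHead_tmul, cross_one] at this
  simpa using this

/-- An invertible braiding of `V` that extends to `⋀ V` and satisfies `∇ τ = p ∇` gives a braided
Hopf structure on `⋀ V`. -/
lemma exists_braidedHopfStructure (hτ : IsExteriorBraiding τ) {p : F}
    (hp : ∀ y : V ⊗[F] V, LinearMap.mul' F _ (TensorProduct.map (ExteriorAlgebra.ι F)
      (ExteriorAlgebra.ι F) (τ y)) = p • LinearMap.mul' F _
        (TensorProduct.map (ExteriorAlgebra.ι F) (ExteriorAlgebra.ι F) y))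
    {τ' : V ⊗[F] V →ₗ[F] V ⊗[F] V}
    (h : τ ∘ₗ τ' = LinearMap.id) (h' : τ' ∘ₗ τ = LinearMap.id) :
    ∃ L : BraidedHopfStructure F (ExteriorAlgebra F V),
      L.braiding.toLinearMap = braid hτ ∧ L.comul = coproduct hτ ∧
        L.antipode = antipodeMap V p := by
  obtain ⟨β', k, k'⟩ := exists_braid_inverse hτ h h'
  have hb := isExtension_braid hτ
  have hbr : (LinearEquiv.ofLinearMap (braid hτ) β' k k').toLinearMap = braid hτ := rfl
  have hmul := hb.double hb |>.natural hb (f := LinearMap.mul' F _) (cross_mul hτ)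
  have hbraid := hb.double hb |>.natural (hb.double hb) (f := braid hτ) (cross_braid hτ)
  have hcomul := hb.natural (hb.double hb) (f := coproduct hτ) (cross_coproduct hτ)
  have hcounit := hb.natural isExtension_comm (cross_counit hτ)
  have hantipode := hb.natural hb (cross_antipode hτ p)
  refine ⟨{
    comul := coproduct hτ
    counit := ExteriorAlgebra.algebraMapInv.toLinearMap
    coassoc := LinearMap.ext (coproduct_coassoc hτ)
    rTensor_counit_comp_comul := LinearMap.ext (counit_rTensor_coproduct hτ)
    lTensor_counit_comp_comul := LinearMap.ext (counit_lTensor_coproduct hτ)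
    braiding := LinearEquiv.ofLinearMap (braid hτ) β' k k'
    antipode := antipodeMap V p
    yang_baxter := ?_
    braiding_one_left := hb.one
    braiding_one_right := ?_
    braiding_mul_left := ?_
    braiding_mul_right := ?_
    braiding_counit_left := ?_
    braiding_counit_right := ?_
    braiding_comul_left := ?_
    braiding_comul_right := hcomul.symm
    braiding_antipode_left := ?_
    braiding_antipode_right := hantipode
    counit_one := map_one ExteriorAlgebra.algebraMapInv
    counit_mul := map_mul ExteriorAlgebra.algebraMapInv
    comul_one := coproduct_one hτ
    comul_mul := TensorProduct.ext' (coproduct_mul hτ)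
    antipode_left := LinearMap.ext (antipode_mul_left hτ hp)
    antipode_right := LinearMap.ext (antipode_mul_right hτ hp) }, hbr, rfl, rfl⟩
  · rw [hbr]
    refine LinearMap.ext fun z => ?_
    have := LinearMap.congr_fun hbraid (TensorProduct.assoc F _ _ _ z)
    simpa [doubleCross, onHead, onFirst, onSecond] using this.symm
  · intro x
    have hη := isExtension_comm.natural hb (f := Algebra.linearMap F (ExteriorAlgebra F V))
      (fun y => by
        induction y using TensorProduct.induction_on with
        | zero => simp
        | add y y' hy hy' => simp only [map_add, hy, hy']
        | tmul v r =>
          simp [Algebra.algebraMap_eq_smul_one, cross_one, TensorProduct.smul_tmul'])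
    simpa using LinearMap.congr_fun hη (x ⊗ₜ 1)
  · rw [hbr]
    refine TensorProduct.ext_threefold fun x y w => ?_
    simp only [LinearMap.comp_apply, LinearMap.rTensor_tmul, LinearMap.mul'_apply, braid_mul_left]
    simp [onHead, onFirst, onSecond]
  · rw [hbr]
    refine LinearMap.ext fun z => ?_
    simpa [doubleCross, onHead, onFirst, onSecond] using
      LinearMap.congr_fun hmul (TensorProduct.assoc F _ _ _ z)
  · rw [hbr]
    refine TensorProduct.ext' fun x w => ?_
    simp [braid_counit_left]
  · rw [hbr]
    refine LinearMap.ext fun z => ?_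
    have := LinearMap.congr_fun hcounit z
    simp only [LinearMap.comp_apply, LinearEquiv.coe_coe] at this ⊢
    rw [← this]
    generalize (ExteriorAlgebra.algebraMapInv (R := F) (M := V)).toLinearMap.lTensor
      (ExteriorAlgebra F V) z = t
    induction t using TensorProduct.induction_on with
    | zero => simp
    | add y y' hy hy' => simp only [map_add, hy, hy']
    | tmul a b => simp
  · rw [hbr]
    refine TensorProduct.ext' fun x w => ?_
    simp only [LinearMap.comp_apply, braid_coproduct_left]
    simp [onHead, onFirst, onSecond]
  · rw [hbr]
    exact TensorProduct.ext' fun x w => by simp [braid_antipode_left]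

/-! ### Uniqueness of the braided Hopf structure -/

/-- A braided Hopf structure is determined by its coproduct, counit, braiding and antipode. -/
lemma BraidedHopfStructure.eq_of_maps_eq {H : Type*} [Ring H] [Algebra F H]
    {L L' : BraidedHopfStructure F H} (hc : L.comul = L'.comul) (he : L.counit = L'.counit)
    (hb : L.braiding.toLinearMap = L'.braiding.toLinearMap) (hs : L.antipode = L'.antipode) :
    L = L' := by
  have hb' := LinearEquiv.toLinearMap_injective hb
  have hC : L.toCoalgebra = L'.toCoalgebra := by
    generalize L.toCoalgebra = C at hc he
    generalize L'.toCoalgebra = C' at hc he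
    obtain @⟨⟨c, e⟩, _, _, _⟩ := C
    obtain @⟨⟨c', e'⟩, _, _, _⟩ := C'
    change c = c' at hc
    change e = e' at he
    subst hc he
    rfl
  obtain @⟨C, b, s⟩ := L
  obtain @⟨C', b', s'⟩ := L'
  change C = C' at hC
  change b = b' at hb'
  change s = s' at hs
  subst hC hb' hs
  rfl

/-- The antipode is the convolution inverse of the identity. -/
lemma antipode_unique {H : Type*} [Ring H] [Algebra F H] [Coalgebra F H] {S S' : H →ₗ[F] H}
    (h : LinearMap.mul' F H ∘ₗ S.rTensor H ∘ₗ Coalgebra.comul =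
      Algebra.linearMap F H ∘ₗ Coalgebra.counit)
    (h' : LinearMap.mul' F H ∘ₗ S'.lTensor H ∘ₗ Coalgebra.comul =
      Algebra.linearMap F H ∘ₗ Coalgebra.counit) : S = S' := by
  have k : WithConv.toConv S * WithConv.toConv LinearMap.id = 1 := congrArg WithConv.toConv h
  have k' : WithConv.toConv LinearMap.id * WithConv.toConv S' = 1 := congrArg WithConv.toConv h'
  exact congrArg WithConv.ofConv (left_inv_eq_right_inv k k')

lemma BraidedHopfStructure.antipode_eq {H : Type*} [Ring H] [Algebra F H]
    {L L' : BraidedHopfStructure F H} (hc : L.comul = L'.comul) (he : L.counit = L'.counit) :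
    L.antipode = L'.antipode := by
  have h' := L'.antipode_right
  rw [← hc, ← he] at h'
  exact @antipode_unique F _ H _ _ L.toCoalgebra _ _ L.antipode_left h'

/-- A braiding compatible with unit and product is determined by its restriction to `V ⊗ V`: its
compatibility in the second variable determines it on `V ⊗ ⋀ V`, that in the first variable on
`⋀ V ⊗ ⋀ V`. -/
lemma braiding_eq_braid (hτ : IsExteriorBraiding τ)
    (L : BraidedHopfStructure F (ExteriorAlgebra F V))
    (hL : ∀ w : V ⊗[F] V,
      L.braiding (TensorProduct.map (ExteriorAlgebra.ι F) (ExteriorAlgebra.ι F) w) =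
      TensorProduct.map (ExteriorAlgebra.ι F) (ExteriorAlgebra.ι F) (τ w)) :
    L.braiding.toLinearMap = braid hτ := by
  have hb := isExtension_braid hτ
  have h1 : ∀ x v, L.braiding (ExteriorAlgebra.ι F v ⊗ₜ x) =
      (ExteriorAlgebra.ι F).lTensor _ (cross hτ (v ⊗ₜ x)) := by
    intro x
    induction x using left_induction with
    | one => intro v; simp [L.braiding_one_right, cross_one]
    | smul r x h => intro v; simp only [TensorProduct.tmul_smul, map_smul, h]
    | add x x' h h' => intro v; simp only [TensorProduct.tmul_add, map_add, h, h']
    | ι_mul u x h =>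
      intro v
      have e := LinearMap.congr_fun L.braiding_mul_right
        ((ExteriorAlgebra.ι F v ⊗ₜ ExteriorAlgebra.ι F u) ⊗ₜ x)
      have e' := hL (v ⊗ₜ u)
      rw [TensorProduct.map_tmul] at e'
      simp only [LinearMap.comp_apply, LinearEquiv.coe_coe, TensorProduct.assoc_tmul,
        LinearMap.lTensor_tmul, LinearMap.mul'_apply, onFirst, LinearMap.rTensor_tmul, e'] at e
      rw [e, cross_ι_mul, onHead_tmul]
      generalize τ (v ⊗ₜ u) = t
      induction t using TensorProduct.induction_on with
      | zero => simp
      | add y y' hy hy' => simp only [TensorProduct.add_tmul, map_add, hy, hy']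
      | tmul c w =>
        simp only [onSecond, LinearMap.comp_apply, LinearEquiv.coe_coe, TensorProduct.map_tmul,
          TensorProduct.assoc_tmul, LinearMap.lTensor_tmul, tail_apply, h]
        generalize cross hτ (w ⊗ₜ x) = s
        induction s using TensorProduct.induction_on with
        | zero => simp
        | add y y' hy hy' => simp only [TensorProduct.tmul_add, map_add, hy, hy']
        | tmul a b => simp
  refine TensorProduct.ext' fun x w => ?_
  rw [LinearEquiv.coe_coe]
  induction x using left_induction with
  | one => rw [L.braiding_one_left, hb.one]
  | smul r x h => simp only [← TensorProduct.smul_tmul', map_smul, h]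
  | add x x' h h' => simp only [TensorProduct.add_tmul, map_add, h, h']
  | ι_mul v x h =>
    have e := LinearMap.congr_fun L.braiding_mul_left ((ExteriorAlgebra.ι F v ⊗ₜ x) ⊗ₜ w)
    simp only [LinearMap.comp_apply, LinearEquiv.coe_coe, TensorProduct.assoc_tmul,
      LinearMap.rTensor_tmul, LinearMap.mul'_apply, onSecond, LinearMap.lTensor_tmul, h] at e
    rw [e, hb.ι_mul]
    generalize braid hτ (x ⊗ₜ w) = t
    induction t using TensorProduct.induction_on with
    | zero => simp
    | add y y' hy hy' => simp only [TensorProduct.tmul_add, map_add, hy, hy']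
    | tmul a b =>
      simp only [onFirst, LinearMap.rTensor_tmul, TensorProduct.assoc_symm_tmul,
        LinearEquiv.coe_coe, h1, crossAct_apply, onHead_tmul]
      generalize cross hτ (v ⊗ₜ a) = s
      induction s using TensorProduct.induction_on with
      | zero => simp
      | add y y' hy hy' => simp only [TensorProduct.add_tmul, map_add, hy, hy']
      | tmul c u => simp

/-- A coproduct for which `V` is primitive satisfies the recursion that defines `coproduct`. -/
lemma comul_eq_coproduct (hτ : IsExteriorBraiding τ)
    (L : BraidedHopfStructure F (ExteriorAlgebra F V))
    (hβ : L.braiding.toLinearMap = braid hτ)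
    (hL : ∀ v : V, L.comul (ExteriorAlgebra.ι F v) =
      ExteriorAlgebra.ι F v ⊗ₜ[F] 1 + 1 ⊗ₜ[F] ExteriorAlgebra.ι F v) :
    L.comul = coproduct hτ := by
  refine linearMap_ext ?_ fun v x h => ?_
  · rw [L.comul_one, coproduct_one]
  · have e := LinearMap.congr_fun L.comul_mul (ExteriorAlgebra.ι F v ⊗ₜ x)
    simp only [LinearMap.comp_apply, LinearMap.mul'_apply, TensorProduct.map_tmul, hL, h, hβ] at e
    rw [e, coproduct_mul, coproduct_ι]

/-- The counit axiom at the primitive element `v` reads `v = ε(v) + v`. -/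
lemma counit_ι (L : BraidedHopfStructure F (ExteriorAlgebra F V))
    (hL : ∀ v : V, L.comul (ExteriorAlgebra.ι F v) =
      ExteriorAlgebra.ι F v ⊗ₜ[F] 1 + 1 ⊗ₜ[F] ExteriorAlgebra.ι F v) (v : V) :
    L.counit (ExteriorAlgebra.ι F v) = 0 := by
  have e := LinearMap.congr_fun L.rTensor_counit_comp_comul (ExteriorAlgebra.ι F v)
  simp only [LinearMap.comp_apply, hL, map_add, LinearMap.rTensor_tmul, L.counit_one,
    TensorProduct.mk_apply, add_eq_right] at e
  have e' := congrArg (TensorProduct.lid F _) e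
  rw [TensorProduct.lid_tmul, map_zero, ← Algebra.algebraMap_eq_smul_one] at e'
  exact (ExteriorAlgebra.algebraMap_eq_zero_iff V _).1 e'

lemma counit_eq_counit {L L' : BraidedHopfStructure F (ExteriorAlgebra F V)}
    (hL : ∀ v : V, L.comul (ExteriorAlgebra.ι F v) =
      ExteriorAlgebra.ι F v ⊗ₜ[F] 1 + 1 ⊗ₜ[F] ExteriorAlgebra.ι F v)
    (hL' : ∀ v : V, L'.comul (ExteriorAlgebra.ι F v) =
      ExteriorAlgebra.ι F v ⊗ₜ[F] 1 + 1 ⊗ₜ[F] ExteriorAlgebra.ι F v) :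
    L.counit = L'.counit := by
  refine linearMap_ext ?_ fun v x h => ?_
  · rw [L.counit_one, L'.counit_one]
  · rw [L.counit_mul, L'.counit_mul, counit_ι L hL, counit_ι L' hL', zero_mul, zero_mul]

lemma existsUnique_isLambda {I : Type*} [LinearOrder I] (𝔹 : Module.Basis I F V) {p : F}
    (hp : p ≠ 0) :
    ∃! L : BraidedHopfStructure F (ExteriorAlgebra F V), IsLambda 𝔹 p L := by
  have hτ := isExteriorBraiding_tau 𝔹 p
  obtain ⟨τ', h, h'⟩ := exists_tau_inverse 𝔹 hp
  obtain ⟨L, hβ, hc, -⟩ := exists_braidedHopfStructure hτ (mul_tau 𝔹 p) h h'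
  have hL : IsLambda 𝔹 p L := by
    refine ⟨fun v => ?_, fun w => ?_⟩
    · rw [hc, coproduct_ι]
    · rw [← LinearEquiv.coe_coe, hβ, braid_map_ι]
  refine ⟨L, hL, fun L' hL' => ?_⟩
  have hβ' := braiding_eq_braid hτ L' hL'.braiding_restrict
  have hc' := comul_eq_coproduct hτ L' hβ' hL'.primitive
  have he' := counit_eq_counit hL'.primitive hL.primitive
  have hc'' := hc'.trans hc.symm
  exact BraidedHopfStructure.eq_of_maps_eq hc'' he' (hβ'.trans hβ.symm)
    (BraidedHopfStructure.antipode_eq hc'' he')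

lemma IsLambda.comul_eq {I : Type*} [LinearOrder I] {𝔹 : Module.Basis I F V} {p : F}
    {L : BraidedHopfStructure F (ExteriorAlgebra F V)} (hL : IsLambda 𝔹 p L) :
    L.comul = coproduct (isExteriorBraiding_tau 𝔹 p) :=
  comul_eq_coproduct _ L (braiding_eq_braid _ L hL.braiding_restrict) hL.primitive

lemma IsLambda.antipode_eq {I : Type*} [LinearOrder I] {𝔹 : Module.Basis I F V} {p : F}
    (hp : p ≠ 0) {L : BraidedHopfStructure F (ExteriorAlgebra F V)} (hL : IsLambda 𝔹 p L) :
    L.antipode = antipodeMap V p := by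
  have hτ := isExteriorBraiding_tau 𝔹 p
  obtain ⟨τ', h, h'⟩ := exists_tau_inverse 𝔹 hp
  obtain ⟨L', -, hc, hs⟩ := exists_braidedHopfStructure hτ (mul_tau 𝔹 p) h h'
  rw [← hs]
  refine BraidedHopfStructure.antipode_eq (hL.comul_eq.trans hc.symm)
    (counit_eq_counit hL.primitive fun v => ?_)
  rw [hc, coproduct_ι]

end Structure
end
end BraidedExterior

/-! ### Structure maps on ordered words -/

namespace BraidedExterior

noncomputable section

section Words

variable {F V I : Type*} [Field F] [AddCommGroup V] [Module F V] [LinearOrder I]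

lemma word_eq_basis (𝔹 : Module.Basis I F V) (E : Finset I) : word 𝔹 E = 𝔹.ExteriorAlgebra E := by
  rw [ExteriorAlgebra.basis_apply_ofCard 𝔹 (rfl : E.card = E.card),
    ExteriorAlgebra.ιMulti_family, ExteriorAlgebra.ιMulti_apply, List.ofFn_eq_map, word,
    ← Finset.listMap_orderEmbOfFin_finRange E rfl, List.map_map]
  rfl

lemma word_empty (𝔹 : Module.Basis I F V) : word 𝔹 ∅ = 1 := by
  simp [word]

lemma word_insert (𝔹 : Module.Basis I F V) {a : I} {E : Finset I} (h : ∀ x ∈ E, a < x) :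
    word 𝔹 (insert a E) = ExteriorAlgebra.ι F (𝔹 a) * word 𝔹 E := by
  rw [word, Finset.sort_insert (· ≤ ·) (fun b hb => (h b hb).le) fun ha => (h a ha).false,
    List.map_cons, List.prod_cons, word]

lemma thetaSet_insert_left {a : I} {A : Finset I} (h : a ∉ A) (B : Finset I) :
    thetaSet (insert a A) B = ∑ b ∈ B, theta a b + thetaSet A B :=
  Finset.sum_insert h

lemma thetaSet_insert_right {a : I} {B : Finset I} (h : a ∉ B) (A : Finset I) :
    thetaSet A (insert a B) = ∑ x ∈ A, theta x a + thetaSet A B := by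
  simp only [thetaSet, Finset.sum_insert h, Finset.sum_add_distrib]

lemma sum_theta_of_lt {a : I} {B : Finset I} (h : ∀ x ∈ B, a < x) : ∑ b ∈ B, theta a b = 0 :=
  Finset.sum_eq_zero fun b hb => if_neg (h b hb).not_gt

lemma sum_theta_of_gt {a : I} {A : Finset I} (h : ∀ x ∈ A, a < x) :
    ∑ x ∈ A, theta x a = A.card := by
  rw [Finset.card_eq_sum_ones]
  exact Finset.sum_congr rfl fun b hb => if_pos (h b hb)

/-- Sorting a generator into a word costs a sign for each smaller letter. -/
lemma ι_mul_word (𝔹 : Module.Basis I F V) (a : I) (G : Finset I) :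
    ExteriorAlgebra.ι F (𝔹 a) * word 𝔹 G =
      if a ∈ G then 0 else (-1 : F) ^ (∑ b ∈ G, theta a b) • word 𝔹 (insert a G) := by
  induction G using Finset.induction_on_min with
  | empty => simp [word]
  | insert c G hc ih =>
    rcases lt_trichotomy a c with h | rfl | h
    · have hG : ∀ x ∈ insert c G, a < x := fun x hx => by
        rcases Finset.mem_insert.1 hx with rfl | hx
        exacts [h, h.trans (hc x hx)]
      rw [if_neg fun ha => (hG a ha).false, sum_theta_of_lt hG, pow_zero, one_smul, word_insert 𝔹 hG]
    · rw [if_pos (Finset.mem_insert_self _ _), word_insert 𝔹 hc, ← mul_assoc,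
        ExteriorAlgebra.ι_sq_zero, zero_mul]
    · have hcG : c ∉ G := fun hx => (hc c hx).false
      rw [word_insert 𝔹 hc, ← mul_assoc, ι_mul_ι_comm, neg_mul, mul_assoc, ih,
        Finset.sum_insert hcG, theta, if_pos h]
      simp only [Finset.mem_insert, or_iff_right h.ne']
      split_ifs with ha
      · simp
      · rw [Finset.insert_comm, word_insert 𝔹 (E := insert a G) fun x hx => ?_, mul_smul_comm,
          pow_add, pow_one, neg_one_mul, neg_smul]
        rcases Finset.mem_insert.1 hx with rfl | hx
        exacts [h, hc x hx]

lemma word_mul_word (𝔹 : Module.Basis I F V) (E G : Finset I) :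
    word 𝔹 E * word 𝔹 G =
      if E ∩ G = ∅ then (-1 : F) ^ thetaSet E G • word 𝔹 (E ∪ G) else 0 := by
  simp only [← Finset.disjoint_iff_inter_eq_empty]
  induction E using Finset.induction_on_min with
  | empty => simp [word_empty, thetaSet]
  | insert a E ha ih =>
    have haE : a ∉ E := fun hx => (ha a hx).false
    rw [word_insert 𝔹 ha, mul_assoc, ih]
    simp only [Finset.disjoint_insert_left]
    by_cases hE : Disjoint E G
    · rw [if_pos hE, mul_smul_comm, ι_mul_word]
      by_cases haG : a ∈ G
      · simp [haG]
      · rw [if_neg (by simp [haE, haG]), if_pos ⟨haG, hE⟩, Finset.sum_union hE,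
          sum_theta_of_lt ha, zero_add, smul_smul, ← pow_add, thetaSet_insert_left haE, add_comm,
          Finset.insert_union]
    · simp [hE]

/-- A letter crosses a word of larger letters at the price of a factor `-p` for each of them. -/
lemma cross_word (𝔹 : Module.Basis I F V) (p : F) {a : I} {A : Finset I} (h : ∀ x ∈ A, a < x) :
    cross (isExteriorBraiding_tau 𝔹 p) (𝔹 a ⊗ₜ word 𝔹 A) =
      (-p) ^ A.card • (word 𝔹 A ⊗ₜ[F] 𝔹 a) := by
  induction A using Finset.induction_on_min with
  | empty => simp [word_empty, cross_one]
  | insert c A hc ih =>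
    rw [word_insert 𝔹 hc, cross_ι_mul, onHead_tmul, tau_lt 𝔹 p (h c (Finset.mem_insert_self _ _)),
      Finset.card_insert_of_notMem fun hx => (hc c hx).false]
    simp only [map_smul, tail_apply, LinearMap.lTensor_tmul,
      ih fun x hx => h x (Finset.mem_insert_of_mem hx),
      TensorProduct.tmul_smul, mergeHead_tmul, leftMul_tmul, smul_smul, ← neg_smul]
    rw [pow_succ', neg_mul]

lemma coproduct_word (𝔹 : Module.Basis I F V) (p : F) (E : Finset I) :
    coproduct (isExteriorBraiding_tau 𝔹 p) (word 𝔹 E) =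
      ∑ A ∈ E.powerset, (-p) ^ thetaSet A (E \ A) • (word 𝔹 A ⊗ₜ[F] word 𝔹 (E \ A)) := by
  induction E using Finset.induction_on_min with
  | empty => simp [word_empty, coproduct_one, thetaSet]
  | insert a E ha ih =>
    have haE : a ∉ E := fun hx => (ha a hx).false
    rw [word_insert 𝔹 ha, coproduct_ι_mul, ih, TensorProduct.tmul_sum, map_sum,
      Finset.sum_powerset_insert haE, ← Finset.sum_add_distrib]
    refine Finset.sum_congr rfl fun A hA => ?_
    rw [Finset.mem_powerset] at hA
    have haA : a ∉ A := fun hx => haE (hA hx)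
    have hlA : ∀ x ∈ A, a < x := fun x hx => ha x (hA hx)
    have hlB : ∀ x ∈ E \ A, a < x := fun x hx => ha x (Finset.mem_sdiff.1 hx).1
    have haB : a ∉ E \ A := fun hx => (hlB a hx).false
    rw [Finset.insert_sdiff_insert, Finset.sdiff_insert_of_notMem haE,
      Finset.insert_sdiff_of_notMem _ haA, thetaSet_insert_left haA, thetaSet_insert_right haB,
      sum_theta_of_lt hlB, sum_theta_of_gt hlA, word_insert 𝔹 hlA, word_insert 𝔹 hlB,
      TensorProduct.tmul_smul, map_smul, primitiveMul_tmul, crossAct_apply, onHead_tmul,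
      cross_word 𝔹 p hlA]
    simp only [map_smul, mergeHead_tmul, leftMul_tmul, tail_apply, LinearMap.lTensor_tmul]
    rw [zero_add, smul_add, smul_smul, pow_add, add_comm, mul_comm]

lemma scale_word (𝔹 : Module.Basis I F V) (p : F) (E : Finset I) :
    scale V p (word 𝔹 E) = p ^ E.card • word 𝔹 E := by
  induction E using Finset.induction_on_min with
  | empty => simp [word_empty]
  | insert a E ha ih =>
    rw [word_insert 𝔹 ha, map_mul, scale_ι, ih,
      Finset.card_insert_of_notMem fun hx => (ha a hx).false, smul_mul_smul_comm, pow_succ']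

lemma signedGauss_succ (p : F) (k : ℕ) :
    signedGauss p (k + 1) = -(signedGauss p k * p ^ k) := by
  rw [signedGauss, signedGauss, Nat.triangle_succ]
  ring

lemma antipodeMap_word (𝔹 : Module.Basis I F V) (p : F) (E : Finset I) :
    antipodeMap V p (word 𝔹 E) = signedGauss p E.card • word 𝔹 E := by
  induction E using Finset.induction_on_min with
  | empty => simp [word_empty, antipodeMap_one, signedGauss]
  | insert a E ha ih =>
    rw [word_insert 𝔹 ha, antipodeMap_ι_mul, ih, map_smul, scale_word, smul_smul, mul_smul_comm,
      Finset.card_insert_of_notMem fun hx => (ha a hx).false, signedGauss_succ, neg_smul]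

end Words
end
end BraidedExterior

theorem mainTheorem2 {F V I : Type*} [Field F] [AddCommGroup V] [Module F V] [LinearOrder I]
    (𝔹 : Module.Basis I F V) (p : F) (hp : p ≠ 0) :
    -- the words `f_E` form a basis of the exterior algebra
    (LinearIndependent F (BraidedExterior.word 𝔹) ∧
      Submodule.span F (Set.range (BraidedExterior.word 𝔹)) = ⊤) ∧
    -- the braided Hopf algebra `Λ_p(V)` exists and is unique
    (∃! L : BraidedExterior.BraidedHopfStructure F (ExteriorAlgebra F V),
      BraidedExterior.IsLambda 𝔹 p L) ∧
    -- product
    (∀ E G : Finset I,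
      LinearMap.mul' F (ExteriorAlgebra F V)
          (BraidedExterior.word 𝔹 E ⊗ₜ[F] BraidedExterior.word 𝔹 G) =
        if E ∩ G = ∅ then
          (-1 : F) ^ BraidedExterior.thetaSet E G • BraidedExterior.word 𝔹 (E ∪ G)
        else 0) ∧
    -- coproduct and antipode
    (∀ L : BraidedExterior.BraidedHopfStructure F (ExteriorAlgebra F V),
      BraidedExterior.IsLambda 𝔹 p L →
      (∀ E : Finset I, L.comul (BraidedExterior.word 𝔹 E) =
        ∑ A ∈ E.powerset, (-p) ^ BraidedExterior.thetaSet A (E \ A) •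
          (BraidedExterior.word 𝔹 A ⊗ₜ[F] BraidedExterior.word 𝔹 (E \ A))) ∧
      (∀ E : Finset I, L.antipode (BraidedExterior.word 𝔹 E) =
        BraidedExterior.signedGauss p E.card • BraidedExterior.word 𝔹 E)) := by
  have hw : BraidedExterior.word 𝔹 = 𝔹.ExteriorAlgebra :=
    funext (BraidedExterior.word_eq_basis 𝔹)
  refine ⟨⟨?_, ?_⟩, BraidedExterior.existsUnique_isLambda 𝔹 hp, fun E G => ?_,
    fun L hL => ⟨fun E => ?_, fun E => ?_⟩⟩
  · rw [hw]
    exact 𝔹.ExteriorAlgebra.linearIndependent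
  · rw [hw]
    exact 𝔹.ExteriorAlgebra.span_eq
  · rw [LinearMap.mul'_apply, BraidedExterior.word_mul_word]
  · rw [hL.comul_eq, BraidedExterior.coproduct_word]
  · rw [hL.antipode_eq hp, BraidedExterior.antipodeMap_word]
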